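/- Let $T>0$, let $\alpha_0>\alpha_1>\dots>\alpha_m\ge 0$ be real numbers, and let $n_i=\lceil\alpha_i\rceil$, i.e. $n_i-1<\alpha_i\le n_i$, $n_i\in\mathbb N_0$. For $\alpha>0$ let $I_{0+}^{\alpha}f(t)=\frac1{\Gamma(\alpha)}\int_0^t(t-\tau)^{\alpha-1}f(\tau)\,d\tau$, $I^0_{0+}f=f$; for $\alpha\ge0$ and $n=\lceil\alpha\rceil$ let $D_{0+}^{\alpha}f=\frac{d^n}{dt^n}I_{0+}^{n-\alpha}f$ and ${}^cD_{0+}^{\alpha}f=D_{0+}^{\alpha}\bigl[f-\sum_{k=0}^{n-1}\frac{f^{(k)}(0)}{k!}t^k\bigr]$ (derivatives at the end points are one-sided). For $0\le\gamma<1$, $C_\gamma[0,T]$ is the set of functions $f$ on $(0,T]$ for which $t^\gamma f(t)$ extends continuously to $[0,T]$; for $n\ge1$, $C^n_\gamma[0,T]$ is the set of functions that are $n-1$ times continuously differentiable on $[0,T]$ and have an $n$-th derivative on $(0,T]$ that belongs to $C_\gamma[0,T]$, with the norm $\sum_{k=0}^{n-1}\sup|f^{(k)}|+\sup|t^\gamma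 f^{(n)}|$. Put $\gamma=n_0-\alpha_0\in[0,1)$. Assume that $n_0=n_1$, that $a_i\in C^1_\gamma[0,T]$ and $D_{0+}^{n_0-\alpha_0}a_i\in C[0,T]$ for $i=1,\dots,m$ (that is, $D_{0+}^{n_0-\alpha_0}a_i$ extends continuously to $[0,T]$), and that $H_0\neq\emptyset$, where $H_j=\{i\in\{1,\dots,m\}:0\le\alpha_i\le j\}$. Let $h_j=\min H_j$, $\Phi_{j+1}(t)=t^j/j!$, $\Phi_{j+1-\alpha_i}=D_{0+}^{\alpha_i}\Phi_{j+1}$. Then for each $j=0,\dots,n_0-1$ the series $$y_j(t)=\Phi_{j+1}(t)+\sum_{k=0}^{\infty}(-1)^{k+1}I_{0+}^{\alpha_0}\Bigl[\sum_{i=1}^m a_i(t)I_{0+}^{\alpha_0-\alpha_i}\Bigr]^k\sum_{i=h_j}^m a_i(t)\Phi_{j+1-\alpha_i}(t)$$ converges absolutely at every $t\in[0,T]$ and in the norm of $C^{n_0}_\gamma[0,T]$, its terms and its sum $y_j$ belong to $C^{n_0}_\gamma[0,T]$, and $y_0,\dots,y_{n_0-1}$ is a canonical fundamental system of the equation $${}^cD_{0+}^{\alpha_0}y(t)=-\sum_{i=1}^m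 a_i(t)\,{}^cD_{0+}^{\alpha_i}y(t),\qquad 0<t<T,$$ that is, every $y_j$ solves it and $y_j^{(k)}(+0)=\delta_{jk}$ for $j,k=0,\dots,n_0-1$. Moreover, for all $b_0,\dots,b_{n_0-1}\in\mathbb R$ this equation with the initial conditions $y^{(k)}(+0)=b_k$, $k=0,\dots,n_0-1$, has a unique solution in $C^{n_0}_\gamma[0,T]$, namely $y=\sum_{j=0}^{n_0-1}b_jy_j$. -/

import Mathlib

noncomputable section

namespace CaputoFDE

/-- Riemann-Liouville fractional integral `I_{0+}^α f`; by convention `I^0 f = f`. -/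
def rlInt (α : ℝ) (f : ℝ → ℝ) (t : ℝ) : ℝ :=
  if α = 0 then f t
  else 1 / Real.Gamma α * ∫ τ in (0 : ℝ)..t, (t - τ) ^ (α - 1) * f τ

/-- Riemann-Liouville fractional derivative `D_{0+}^α f = d^n/dt^n I_{0+}^{n-α} f` on `(0, T]`, where
`n` is the integer with `n - 1 < α ≤ n`. At interior points the derivative is the two-sided one; at
`T` it is the left derivative, so that only the values of `f` on `[0, T]` matter. -/
def rlDeriv (T α : ℝ) (f : ℝ → ℝ) (t : ℝ) : ℝ :=
  iteratedDerivWithin ⌈α⌉₊ (rlInt (⌈α⌉₊ - α) f) (Set.Ioc 0 T) t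

/-- The value at `t = +0` of the `k`-th derivative of a function on `[0, T]`. -/
def derivAtZero (T : ℝ) (k : ℕ) (f : ℝ → ℝ) : ℝ :=
  iteratedDerivWithin k f (Set.Icc 0 T) 0

/-- Caputo fractional derivative: the Riemann-Liouville derivative of `f` minus its Taylor
polynomial of degree `n - 1` at `0`, where `n - 1 < α ≤ n`. -/
def caputoDeriv (T α : ℝ) (f : ℝ → ℝ) (t : ℝ) : ℝ :=
  rlDeriv T α
    (fun s => f s - ∑ k ∈ Finset.range ⌈α⌉₊, derivAtZero T k f / (k.factorial : ℝ) * s ^ k) t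

/-- `f ∈ C_γ[0, T]`: `f` is given on `(0, T]` and `t ^ γ * f t` extends continuously to `[0, T]`. -/
def MemC (γ T : ℝ) (f : ℝ → ℝ) : Prop :=
  ∃ g : ℝ → ℝ, ContinuousOn g (Set.Icc 0 T) ∧ ∀ t ∈ Set.Ioc 0 T, g t = t ^ γ * f t

/-- `f ∈ C_γ^n[0, T]`: for `n ≥ 1`, `f` is `n - 1` times continuously differentiable on `[0, T]`, its
`n`-th derivative exists on `(0, T]`, and this derivative belongs to `C_γ[0, T]`. -/
def MemCn (γ T : ℝ) : ℕ → (ℝ → ℝ) → Prop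
  | 0, f => MemC γ T f
  | n + 1, f =>
      ContDiffOn ℝ n f (Set.Icc 0 T) ∧
      (∀ t ∈ Set.Ioc 0 T,
        DifferentiableWithinAt ℝ (iteratedDerivWithin n f (Set.Icc 0 T)) (Set.Icc 0 T) t) ∧
      MemC γ T (iteratedDerivWithin (n + 1) f (Set.Icc 0 T))

/-- Convergence in the norm `∑_{k<n} sup |f^{(k)}| + sup |t ^ γ f^{(n)}|` of `C_γ^n[0, T]`. -/
def TendstoCn (γ T : ℝ) (n : ℕ) (F : ℕ → ℝ → ℝ) (f : ℝ → ℝ) : Prop :=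
  (∀ k < n, TendstoUniformlyOn (fun N => iteratedDerivWithin k (F N) (Set.Icc 0 T))
    (iteratedDerivWithin k f (Set.Icc 0 T)) Filter.atTop (Set.Icc 0 T)) ∧
  TendstoUniformlyOn (fun N t => t ^ γ * iteratedDerivWithin n (F N) (Set.Icc 0 T) t)
    (fun t => t ^ γ * iteratedDerivWithin n f (Set.Icc 0 T) t) Filter.atTop (Set.Ioc 0 T)

/-- The equation `D^{α_0} y = - ∑_{i=1}^m a_i D^{α_i} y` on `(0, T)`, with Caputo derivatives. -/
def SolvesEq (T : ℝ) (m : ℕ) (α : ℕ → ℝ) (a : ℕ → ℝ → ℝ) (y : ℝ → ℝ) : Prop :=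
  ∀ t ∈ Set.Ioo 0 T,
    caputoDeriv T (α 0) y t = -∑ i ∈ Finset.Icc 1 m, a i t * caputoDeriv T (α i) y t

/-- The initial value problem: the equation, and `D^k y (+0) = b_k` for `k = 0, …, n_0 - 1`. -/
def SolvesIVP (T : ℝ) (m : ℕ) (α : ℕ → ℝ) (a : ℕ → ℝ → ℝ) (b : ℕ → ℝ) (y : ℝ → ℝ) : Prop :=
  SolvesEq T m α a y ∧ ∀ k < ⌈α 0⌉₊, derivAtZero T k y = b k

/-- `Y_0, …, Y_{n_0 - 1}` is a canonical fundamental system of solutions of the equation. -/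
def IsCanonicalSystem (T : ℝ) (m : ℕ) (α : ℕ → ℝ) (a : ℕ → ℝ → ℝ) (Y : ℕ → ℝ → ℝ) : Prop :=
  ∀ j < ⌈α 0⌉₊, SolvesEq T m α a (Y j) ∧
    ∀ k < ⌈α 0⌉₊, derivAtZero T k (Y j) = if j = k then 1 else 0

/-- `H_j = {i : 0 ≤ α_i ≤ j, i = 1, …, m}`. -/
def H (m : ℕ) (α : ℕ → ℝ) (j : ℕ) : Set ℕ :=
  {i | 1 ≤ i ∧ i ≤ m ∧ 0 ≤ α i ∧ α i ≤ j}

/-- `h_j = min H_j` (used only when `H_j` is non-empty). -/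
def h (m : ℕ) (α : ℕ → ℝ) (j : ℕ) : ℕ := sInf (H m α j)

/-- `Φ_{j+1}(t) = t ^ j / j!`. -/
def Phi (j : ℕ) (t : ℝ) : ℝ := t ^ j / (j.factorial : ℝ)

/-- The operator `∑_{i=1}^m a_i(t) I_{0+}^{α_0 - α_i}`. -/
def opK (m : ℕ) (α : ℕ → ℝ) (a : ℕ → ℝ → ℝ) (f : ℝ → ℝ) (t : ℝ) : ℝ :=
  ∑ i ∈ Finset.Icc 1 m, a i t * rlInt (α 0 - α i) f t

/-- `∑_{i=h_j}^m a_i(t) Φ_{j+1-α_i}(t)`, where `Φ_{j+1-α} = D_{0+}^α Φ_{j+1}`. -/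
def source (T : ℝ) (m : ℕ) (α : ℕ → ℝ) (a : ℕ → ℝ → ℝ) (j : ℕ) (t : ℝ) : ℝ :=
  ∑ i ∈ Finset.Icc (h m α j) m, a i t * rlDeriv T (α i) (Phi j) t

/-- The `k`-th term of the series for `y_j`. -/
def seriesTerm (T : ℝ) (m : ℕ) (α : ℕ → ℝ) (a : ℕ → ℝ → ℝ) (j k : ℕ) (t : ℝ) : ℝ :=
  (-1) ^ (k + 1) * rlInt (α 0) ((opK m α a)^[k] (source T m α a j)) t

/-- The function `y_j` given by the series. -/
def ySeries (T : ℝ) (m : ℕ) (α : ℕ → ℝ) (a : ℕ → ℝ → ℝ) (j : ℕ) (t : ℝ) : ℝ :=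
  Phi j t + ∑' k, seriesTerm T m α a j k t

end CaputoFDE

end

/-! The equation is reduced to a Volterra equation for a single function. By Taylor's formula with
integral remainder, the elements of C^n_γ, n = ⌈α_0⌉, are exactly the functions Σ b_k t^k/k! + I^n v
with v ∈ C_γ (`memCn_taylorSum_add_rlInt`, `MemCn.eqOn_taylorSum_add_rlInt`). Put u = I^γ v. Since γ
+ α_0 = n, the semigroup law gives I^n v = I^{α_0} u. Hence the Caputo derivative of order α_0 is u,
and the one of order β ≤ α_0 is I^{α_0-β} u plus the derivatives of the Taylor monomials of degree
at least β (`caputoDeriv_eq`). The equation becomes u = -(K u + f) with K = `opK` and f = Σ b_k f_k,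
where f_k is the `source` of index k (`solvesEq_iff`).

K contains only integrals of positive order α_0 - α_i, so a large exponential weight makes it a
contraction on bounded functions; this gives uniqueness (`eqOn_zero_of_eq_neg_opK`).

For existence, smallness of u is not enough: convergence in C^n_γ is a statement about v. Therefore
K is iterated on functions c + ∫w with w ∈ C_μ, μ < 1 (`HasPrim`). This class contains the sources,
is stable under K by the product rule for a_i ∈ C^1_γ, and consists of functions I^γ v with v ∈ C_γ
(`HasPrim.exists_rlInt_eq`). On primitives K I^1 w = I^1 L w with L = `opL`, and L contracts a
weighted norm (`exists_opL_contraction`). So K^k f = I^γ v_k with v_k geometrically small in C_γ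
(`exists_rlInt_eq_iterate_opK`), and the Neumann series converges in all the required senses
(`exists_neumann_series`). -/

namespace CaputoFDE

open Set Filter Topology MeasureTheory

/-! ### Beta integrals and bounds for weakly singular kernels. -/

/-- The normalised power `t ^ (p - 1) / Γ(p)`, the Riemann-Liouville kernel of order `p`. -/
noncomputable def normPow (p t : ℝ) : ℝ := t ^ (p - 1) / Real.Gamma p

/-- The Beta integral rescaled to `[0, t]`, read off from its complex form because all bases are
nonnegative there. -/
lemma integral_sub_rpow_mul_rpow {q μ t : ℝ} (hq : 0 < q) (hμ : μ < 1) (ht : 0 < t) :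
    ∫ s in (0 : ℝ)..t, (t - s) ^ (q - 1) * s ^ (-μ) =
      t ^ (q - μ) * (Real.Gamma (1 - μ) * Real.Gamma q / Real.Gamma (1 - μ + q)) := by
  have h1 := Complex.betaIntegral_scaled ((1 - μ : ℝ) : ℂ) (q : ℂ) ht
  rw [Complex.betaIntegral_eq_Gamma_mul_div _ _ (by simpa using hμ) (by simpa using hq),
    ← Complex.ofReal_add, Complex.Gamma_ofReal, Complex.Gamma_ofReal, Complex.Gamma_ofReal] at h1
  have h2 : ∫ x in (0 : ℝ)..t, (x : ℂ) ^ (((1 - μ : ℝ) : ℂ) - 1) * ((t : ℂ) - x) ^ ((q : ℂ) - 1) =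
      ∫ x in (0 : ℝ)..t, (((t - x) ^ (q - 1) * x ^ (-μ) : ℝ) : ℂ) := by
    refine intervalIntegral.integral_congr fun x hx => ?_
    rw [uIcc_of_le ht.le] at hx
    have e1 : (((1 - μ : ℝ) : ℂ) - 1) = ((-μ : ℝ) : ℂ) := by push_cast; ring
    have e2 : ((q : ℂ) - 1) = ((q - 1 : ℝ) : ℂ) := by push_cast; ring
    rw [e1, e2, ← Complex.ofReal_sub, ← Complex.ofReal_cpow hx.1,
      ← Complex.ofReal_cpow (sub_nonneg.2 hx.2), ← Complex.ofReal_mul, mul_comm]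
  rw [h2, intervalIntegral.integral_ofReal] at h1
  have e3 : (((1 - μ + q : ℝ) : ℂ) - 1) = ((q - μ : ℝ) : ℂ) := by push_cast; ring
  rw [e3, ← Complex.ofReal_cpow ht.le] at h1
  exact_mod_cast h1

lemma intervalIntegrable_sub_rpow_mul_rpow {q μ t : ℝ} (hq : 0 < q) (hμ : μ < 1) (ht : 0 < t) :
    IntervalIntegrable (fun s => (t - s) ^ (q - 1) * s ^ (-μ)) volume 0 t := by
  -- A non-integrable function has integral 0 by convention, whereas the Beta formula, valid in any
  -- case, gives a positive value.
  by_contra hcon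
  have h1 := integral_sub_rpow_mul_rpow hq hμ ht
  rw [intervalIntegral.integral_undef hcon] at h1
  have h2 := Real.Gamma_pos_of_pos hq
  have h3 := Real.Gamma_pos_of_pos (sub_pos.2 hμ)
  have h4 : 0 < Real.Gamma (1 - μ + q) := Real.Gamma_pos_of_pos (by linarith)
  have h5 := Real.rpow_pos_of_pos ht (q - μ)
  have : 0 < t ^ (q - μ) * (Real.Gamma (1 - μ) * Real.Gamma q / Real.Gamma (1 - μ + q)) := by
    positivity
  linarith

lemma abs_integral_le_of_le_rpow {F : ℝ → ℝ} {C q μ t : ℝ} (hq : 0 < q) (hμ : μ < 1) (ht : 0 < t)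
    (hF : ∀ s ∈ Ioo 0 t, |F s| ≤ C * ((t - s) ^ (q - 1) * s ^ (-μ))) :
    |∫ s in (0 : ℝ)..t, F s| ≤
      C * (t ^ (q - μ) * (Real.Gamma (1 - μ) * Real.Gamma q / Real.Gamma (1 - μ + q))) := by
  rw [← integral_sub_rpow_mul_rpow hq hμ ht, ← intervalIntegral.integral_const_mul]
  rw [← Real.norm_eq_abs]
  refine intervalIntegral.norm_integral_le_of_norm_le ht.le ?_
    ((intervalIntegrable_sub_rpow_mul_rpow hq hμ ht).const_mul C)
  have hne : ∀ᵐ s : ℝ, s ≠ t := by simp [ae_iff]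
  filter_upwards [hne] with s hs hs'
  exact hF s ⟨hs'.1, lt_of_le_of_ne hs'.2 hs⟩

/-! ### The weighted spaces C_γ. -/

section MemC

variable {T μ ν : ℝ} {f g : ℝ → ℝ}

lemma MemC.congr (hf : MemC μ T f) (hfg : EqOn f g (Ioc 0 T)) : MemC μ T g := by
  obtain ⟨k, hk, hk'⟩ := hf
  exact ⟨k, hk, fun t ht => by rw [hk' t ht, hfg ht]⟩

lemma MemC.add (hf : MemC μ T f) (hg : MemC μ T g) : MemC μ T (fun t => f t + g t) := by
  obtain ⟨k, hk, hk'⟩ := hf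
  obtain ⟨l, hl, hl'⟩ := hg
  exact ⟨fun t => k t + l t, hk.add hl, fun t ht => by simp only [hk' t ht, hl' t ht]; ring⟩

lemma MemC.const_mul (c : ℝ) (hf : MemC μ T f) : MemC μ T (fun t => c * f t) := by
  obtain ⟨k, hk, hk'⟩ := hf
  exact ⟨fun t => c * k t, continuousOn_const.mul hk, fun t ht => by simp only [hk' t ht]; ring⟩

lemma MemC.neg (hf : MemC μ T f) : MemC μ T (fun t => -f t) :=
  (hf.const_mul (-1)).congr fun t _ => by simp

lemma MemC.sub (hf : MemC μ T f) (hg : MemC μ T g) : MemC μ T (fun t => f t - g t) :=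
  (hf.add hg.neg).congr fun t _ => by simp [sub_eq_add_neg]

lemma memC_zero : MemC μ T (fun _ => 0) := ⟨fun _ => 0, continuousOn_const, by simp⟩

lemma MemC.sum {ι : Type*} {s : Finset ι} {F : ι → ℝ → ℝ} (hF : ∀ i ∈ s, MemC μ T (F i)) :
    MemC μ T (fun t => ∑ i ∈ s, F i t) := by
  classical
  induction s using Finset.induction_on with
  | empty => simpa using memC_zero
  | insert i s hi ih =>
    simp only [Finset.sum_insert hi]
    exact (hF i (by simp)).add (ih fun j hj => hF j (by simp [hj]))

lemma MemC.mul (hf : MemC μ T f) (hg : MemC ν T g) : MemC (μ + ν) T (fun t => f t * g t) := by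
  obtain ⟨k, hk, hk'⟩ := hf
  obtain ⟨l, hl, hl'⟩ := hg
  refine ⟨fun t => k t * l t, hk.mul hl, fun t ht => ?_⟩
  simp only [hk' t ht, hl' t ht, Real.rpow_add ht.1]
  ring

lemma memC_zero_of_continuousOn (hf : ContinuousOn f (Icc 0 T)) : MemC 0 T f :=
  ⟨f, hf, fun t _ => by simp⟩

lemma MemC.mono (hf : MemC μ T f) (h : μ ≤ ν) : MemC ν T f := by
  rcases h.eq_or_lt with rfl | h
  · exact hf
  obtain ⟨k, hk, hk'⟩ := hf
  refine ⟨fun t => t ^ (ν - μ) * k t,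
    (Real.continuous_rpow_const (by linarith)).continuousOn.mul hk, fun t ht => ?_⟩
  simp only [hk' t ht]
  rw [← mul_assoc, ← Real.rpow_add ht.1]
  congr 2
  ring

lemma memC_normPow (p : ℝ) : MemC (1 - p) T (normPow p) := by
  refine ⟨fun _ => 1 / Real.Gamma p, continuousOn_const, fun t ht => ?_⟩
  rw [normPow, ← mul_div_assoc, ← Real.rpow_add ht.1]
  simp

lemma MemC.continuousOn (hf : MemC μ T f) : ContinuousOn f (Ioc 0 T) := by
  obtain ⟨k, hk, hk'⟩ := hf
  have : ContinuousOn (fun t => t ^ (-μ) * k t) (Ioc 0 T) :=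
    (ContinuousOn.rpow_const continuousOn_id fun t ht => Or.inl ht.1.ne').mul
      (hk.mono Ioc_subset_Icc_self)
  refine this.congr fun t ht => ?_
  simp only [hk' t ht]
  rw [← mul_assoc, ← Real.rpow_add ht.1]
  simp

/-- Convolution needs a measurable function on the whole line. The argument of the continuous factor
is clamped to `[0, T]`, and the function is cut off to the left of 0; the indicator in the bound
records this support. -/
lemma MemC.exists_extension (hT : 0 < T) (hf : MemC μ T f) :
    ∃ M, 0 ≤ M ∧ ∃ F : ℝ → ℝ, Measurable F ∧ EqOn F f (Ioc 0 T) ∧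
      ∀ s, |F s| ≤ M * (Ioi (0 : ℝ)).indicator (fun s => s ^ (-μ)) s := by
  obtain ⟨k, hk, hk'⟩ := hf
  obtain ⟨M, hM⟩ := isCompact_Icc.exists_bound_of_continuousOn hk
  have hM0 : 0 ≤ M := (norm_nonneg _).trans (hM 0 ⟨le_rfl, hT.le⟩)
  refine ⟨M, hM0, (Ioi (0 : ℝ)).indicator fun s => s ^ (-μ) * k (projIcc 0 T hT.le s), ?_, ?_, ?_⟩
  · refine Measurable.indicator ?_ measurableSet_Ioi
    have : Continuous fun s => k (projIcc 0 T hT.le s) :=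
      (continuousOn_iff_continuous_domRestrict.1 hk).comp continuous_projIcc
    exact (measurable_id.pow_const _).mul this.measurable
  · intro t ht
    rw [indicator_of_mem (show t ∈ Ioi (0 : ℝ) from ht.1), projIcc_of_mem hT.le ⟨ht.1.le, ht.2⟩]
    simp only [hk' t ht]
    rw [← mul_assoc, ← Real.rpow_add ht.1]
    simp
  · intro s
    by_cases hs : s ∈ Ioi (0 : ℝ)
    · rw [indicator_of_mem hs, indicator_of_mem hs, abs_mul, mul_comm,
        abs_of_nonneg (Real.rpow_nonneg (le_of_lt hs) _)]
      exact mul_le_mul_of_nonneg_right (hM _ (projIcc 0 T hT.le s).2)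
        (Real.rpow_nonneg (le_of_lt hs) _)
    · simp [indicator_of_notMem hs]

lemma MemC.exists_bound (hT : 0 < T) (hf : MemC μ T f) :
    ∃ M, 0 ≤ M ∧ ∀ s ∈ Ioc 0 T, |f s| ≤ M * s ^ (-μ) := by
  obtain ⟨M, hM, F, -, hF, hb⟩ := hf.exists_extension hT
  refine ⟨M, hM, fun s hs => ?_⟩
  have := hb s
  rwa [hF hs, indicator_of_mem (show s ∈ Ioi (0 : ℝ) from hs.1)] at this

end MemC

/-! ### Elementary properties of the fractional integral. -/

section rlInt

variable {T μ t β : ℝ} {f g : ℝ → ℝ}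

lemma rlInt_zero_order : rlInt 0 f = f := by ext t; simp [rlInt]

lemma rlInt_of_pos (hβ : 0 < β) :
    rlInt β f t = 1 / Real.Gamma β * ∫ τ in (0 : ℝ)..t, (t - τ) ^ (β - 1) * f τ := by
  rw [rlInt, if_neg hβ.ne']

lemma rlInt_one : rlInt 1 f t = ∫ τ in (0 : ℝ)..t, f τ := by simp [rlInt]

lemma rlInt_at_zero (hβ : 0 < β) : rlInt β f 0 = 0 := by simp [rlInt_of_pos hβ]

lemma rlInt_congr_Ioo (hβ : 0 < β) (ht : 0 ≤ t) (hfg : EqOn f g (Ioo 0 t)) :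
    rlInt β f t = rlInt β g t := by
  rw [rlInt_of_pos hβ, rlInt_of_pos hβ, intervalIntegral.integral_of_le ht,
    intervalIntegral.integral_of_le ht, integral_Ioc_eq_integral_Ioo, integral_Ioc_eq_integral_Ioo]
  congr 1
  exact setIntegral_congr_fun measurableSet_Ioo fun _ hs => by simp only [hfg hs]

lemma rlInt_congr (hβ : 0 ≤ β) (hfg : EqOn f g (Ioc 0 T)) :
    EqOn (rlInt β f) (rlInt β g) (Ioc 0 T) := by
  intro t ht
  rcases hβ.eq_or_lt with rfl | hβ
  · simpa [rlInt_zero_order] using hfg ht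
  · exact rlInt_congr_Ioo hβ ht.1.le fun s hs => hfg ⟨hs.1, hs.2.le.trans ht.2⟩

lemma rlInt_congr_Icc (hβ : 0 < β) (hfg : EqOn f g (Ioc 0 T)) :
    EqOn (rlInt β f) (rlInt β g) (Icc 0 T) := fun _ ht =>
  rlInt_congr_Ioo hβ ht.1 fun _ hs => hfg ⟨hs.1, hs.2.le.trans ht.2⟩

lemma rlInt_const_mul (c : ℝ) : rlInt β (fun s => c * f s) t = c * rlInt β f t := by
  unfold rlInt
  split_ifs
  · rfl
  · rw [mul_left_comm, ← intervalIntegral.integral_const_mul c]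
    congr 2
    ext s
    ring

lemma MemC.intervalIntegrable (hT : 0 < T) (hf : MemC μ T f) (hμ : μ < 1) (hβ : 0 < β)
    (ht : t ∈ Icc 0 T) : IntervalIntegrable (fun s => (t - s) ^ (β - 1) * f s) volume 0 t := by
  rcases ht.1.eq_or_lt with rfl | ht0
  · simp
  obtain ⟨M, -, F, hFm, hF, hb⟩ := hf.exists_extension hT
  have h1 : IntervalIntegrable (fun s => (t - s) ^ (β - 1) * F s) volume 0 t := by
    refine ((intervalIntegrable_sub_rpow_mul_rpow hβ hμ ht0).const_mul M).mono_fun' ?_ ?_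
    · exact (((measurable_const.sub measurable_id).pow_const _).mul hFm).aestronglyMeasurable
    · rw [uIoc_of_le ht.1]
      filter_upwards [ae_restrict_mem measurableSet_Ioc] with s hs
      have := hb s
      rw [indicator_of_mem (show s ∈ Ioi (0 : ℝ) from hs.1)] at this
      have h0 : 0 ≤ (t - s) ^ (β - 1) := Real.rpow_nonneg (sub_nonneg.2 hs.2) _
      rw [Real.norm_eq_abs, abs_mul, abs_of_nonneg h0]
      calc (t - s) ^ (β - 1) * |F s| ≤ (t - s) ^ (β - 1) * (M * s ^ (-μ)) := by gcongr
        _ = _ := by ring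
  refine h1.congr ?_
  rw [uIoc_of_le ht.1]
  intro s hs
  simp only [hF ⟨hs.1, hs.2.trans ht.2⟩]

lemma rlInt_add (hT : 0 < T) (hf : MemC μ T f) (hg : MemC μ T g) (hμ : μ < 1) (hβ : 0 ≤ β)
    (ht : t ∈ Icc 0 T) :
    rlInt β (fun s => f s + g s) t = rlInt β f t + rlInt β g t := by
  rcases hβ.eq_or_lt with rfl | hβ
  · simp [rlInt_zero_order]
  · rw [rlInt_of_pos hβ, rlInt_of_pos hβ, rlInt_of_pos hβ, ← mul_add,
      ← intervalIntegral.integral_add (hf.intervalIntegrable hT hμ hβ ht)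
        (hg.intervalIntegrable hT hμ hβ ht)]
    simp only [mul_add]

lemma rlInt_sub (hT : 0 < T) (hf : MemC μ T f) (hg : MemC μ T g) (hμ : μ < 1) (hβ : 0 ≤ β)
    (ht : t ∈ Icc 0 T) :
    rlInt β (fun s => f s - g s) t = rlInt β f t - rlInt β g t := by
  have := rlInt_add hT hf (hg.const_mul (-1)) hμ hβ ht
  rw [rlInt_const_mul] at this
  rw [sub_eq_add_neg, ← neg_one_mul, ← this]
  congr 1
  ext s
  ring

lemma rlInt_zero_fun : rlInt β (fun _ => 0) t = 0 := by simp [rlInt]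

lemma rlInt_sum (hT : 0 < T) {ι : Type*} {s : Finset ι} {F : ι → ℝ → ℝ}
    (hF : ∀ i ∈ s, MemC μ T (F i)) (hμ : μ < 1) (hβ : 0 ≤ β) (ht : t ∈ Icc 0 T) :
    rlInt β (fun x => ∑ i ∈ s, F i x) t = ∑ i ∈ s, rlInt β (F i) t := by
  classical
  induction s using Finset.induction_on with
  | empty => simpa using rlInt_zero_fun
  | insert i s hi ih =>
    simp only [Finset.sum_insert hi]
    rw [rlInt_add hT (hF i (by simp)) (MemC.sum fun j hj => hF j (by simp [hj])) hμ hβ ht,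
      ih fun j hj => hF j (by simp [hj])]

lemma abs_rlInt_le {M : ℝ} (hβ : 0 < β) (hμ : μ < 1) (ht : 0 < t)
    (hf : ∀ s ∈ Ioo 0 t, |f s| ≤ M * s ^ (-μ)) :
    |rlInt β f t| ≤ M * (Real.Gamma (1 - μ) / Real.Gamma (1 - μ + β)) * t ^ (β - μ) := by
  have hG := Real.Gamma_pos_of_pos hβ
  have := abs_integral_le_of_le_rpow (F := fun s => (t - s) ^ (β - 1) * f s) (C := M) hβ hμ ht ?_
  · rw [rlInt_of_pos hβ, abs_mul, abs_of_pos (by positivity)]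
    refine (mul_le_mul_of_nonneg_left this (by positivity)).trans_eq ?_
    field_simp
  · intro s hs
    have h0 : 0 ≤ (t - s) ^ (β - 1) := Real.rpow_nonneg (sub_nonneg.2 hs.2.le) _
    rw [abs_mul, abs_of_nonneg h0]
    calc (t - s) ^ (β - 1) * |f s| ≤ (t - s) ^ (β - 1) * (M * s ^ (-μ)) := by
          gcongr; exact hf s hs
      _ = _ := by ring

lemma rlInt_normPow {p : ℝ} (hp : 0 < p) (hβ : 0 ≤ β) (ht : 0 < t) :
    rlInt β (normPow p) t = normPow (p + β) t := by
  rcases hβ.eq_or_lt with rfl | hβ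
  · simp [rlInt_zero_order]
  have h := integral_sub_rpow_mul_rpow (μ := 1 - p) hβ (by linarith) ht
  have hG := Real.Gamma_pos_of_pos hβ
  have hG' := Real.Gamma_pos_of_pos hp
  have e : (fun τ => (t - τ) ^ (β - 1) * normPow p τ) =
      fun τ => (1 / Real.Gamma p) * ((t - τ) ^ (β - 1) * τ ^ (-(1 - p))) := by
    ext τ
    rw [normPow, neg_sub]
    ring
  rw [rlInt_of_pos hβ, e, intervalIntegral.integral_const_mul, h, normPow,
    show β - (1 - p) = p + β - 1 by ring, show 1 - (1 - p) = p by ring]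
  field_simp

end rlInt

/-! ### The semigroup law by convolution. -/

section semigroup

open ContinuousLinearMap (mul)

/-- The convolution kernel of the Riemann-Liouville integral of order `β`. -/
noncomputable def rlKernel (β : ℝ) : ℝ → ℝ := (Ioi (0 : ℝ)).indicator (normPow β)

lemma measurable_rlKernel (β : ℝ) : Measurable (rlKernel β) :=
  ((measurable_id.pow_const _).div_const _).indicator measurableSet_Ioi

lemma rlKernel_nonneg {β : ℝ} (hβ : 0 < β) (s : ℝ) : 0 ≤ rlKernel β s :=
  indicator_nonneg (fun _ hx => div_nonneg (Real.rpow_nonneg (le_of_lt hx) _)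
    (Real.Gamma_pos_of_pos hβ).le) s

variable {F : ℝ → ℝ} {M μ α β x : ℝ}

lemma mul_rlKernel_eq_indicator (hF : ∀ s, |F s| ≤ M * (Ioi (0 : ℝ)).indicator (fun s => s ^ (-μ)) s) :
    (fun s => F s * rlKernel β (x - s)) =
      (Ioo 0 x).indicator fun s => 1 / Real.Gamma β * ((x - s) ^ (β - 1) * F s) := by
  ext s
  by_cases hs : s ∈ Ioo 0 x
  · rw [indicator_of_mem hs, rlKernel, indicator_of_mem (show x - s ∈ Ioi (0 : ℝ) from
      sub_pos.2 hs.2), normPow]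
    ring
  · rw [indicator_of_notMem hs]
    by_cases h0 : 0 < s
    · have : x - s ∉ Ioi (0 : ℝ) := fun h => hs ⟨h0, sub_pos.1 h⟩
      rw [rlKernel, indicator_of_notMem this, mul_zero]
    · have := hF s
      rw [indicator_of_notMem (show s ∉ Ioi (0 : ℝ) from h0), mul_zero] at this
      rw [abs_nonpos_iff.1 this, zero_mul]

lemma convolutionExistsAt_rlKernel (hFm : Measurable F)
    (hF : ∀ s, |F s| ≤ M * (Ioi (0 : ℝ)).indicator (fun s => s ^ (-μ)) s) (hμ : μ < 1)
    (hβ : 0 < β) : ConvolutionExistsAt F (rlKernel β) x (mul ℝ ℝ) := by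
  unfold ConvolutionExistsAt
  simp only [ContinuousLinearMap.mul_apply']
  rw [mul_rlKernel_eq_indicator hF, integrable_indicator_iff measurableSet_Ioo]
  rcases le_or_gt x 0 with hx | hx
  · simp [Ioo_eq_empty (not_lt.2 hx)]
  refine Integrable.const_mul (Integrable.mono'
    (g := fun s => M * ((x - s) ^ (β - 1) * s ^ (-μ))) ?_ ?_ ?_) _
  · have := ((intervalIntegrable_sub_rpow_mul_rpow hβ hμ hx).const_mul M)
    rwa [intervalIntegrable_iff_integrableOn_Ioo_of_le hx.le] at this
  · exact (((measurable_const.sub measurable_id).pow_const _).mul hFm).aestronglyMeasurable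
  · filter_upwards [ae_restrict_mem measurableSet_Ioo] with s hs
    have := hF s
    rw [indicator_of_mem (show s ∈ Ioi (0 : ℝ) from hs.1)] at this
    have h0 : 0 ≤ (x - s) ^ (β - 1) := Real.rpow_nonneg (sub_nonneg.2 hs.2.le) _
    rw [Real.norm_eq_abs, abs_mul, abs_of_nonneg h0]
    calc (x - s) ^ (β - 1) * |F s| ≤ (x - s) ^ (β - 1) * (M * s ^ (-μ)) := by gcongr
      _ = _ := by ring

lemma convolution_rlKernel (hF : ∀ s, |F s| ≤ M * (Ioi (0 : ℝ)).indicator (fun s => s ^ (-μ)) s)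
    (hβ : 0 < β) :
    convolution F (rlKernel β) (mul ℝ ℝ) volume = (Ioi (0 : ℝ)).indicator (rlInt β F) := by
  ext x
  unfold convolution
  simp only [ContinuousLinearMap.mul_apply']
  rw [mul_rlKernel_eq_indicator hF, integral_indicator measurableSet_Ioo]
  rcases le_or_gt x 0 with hx | hx
  · rw [Ioo_eq_empty (not_lt.2 hx), indicator_of_notMem (show x ∉ Ioi (0 : ℝ) from not_lt.2 hx)]
    simp
  · rw [indicator_of_mem (show x ∈ Ioi (0 : ℝ) from hx), rlInt_of_pos hβ,
      intervalIntegral.integral_of_le hx.le, integral_Ioc_eq_integral_Ioo, integral_const_mul]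

lemma abs_rlKernel_le (hβ : 0 < β) (s : ℝ) :
    |rlKernel β s| ≤ 1 / Real.Gamma β * (Ioi (0 : ℝ)).indicator (fun s => s ^ (-(1 - β))) s := by
  rw [abs_of_nonneg (rlKernel_nonneg hβ s), rlKernel]
  by_cases hs : s ∈ Ioi (0 : ℝ)
  · rw [indicator_of_mem hs, indicator_of_mem hs, normPow, neg_sub, one_div_mul_eq_div]
  · simp [indicator_of_notMem hs]

lemma convolution_rlKernel_rlKernel (hα : 0 < α) (hβ : 0 < β) :
    convolution (rlKernel β) (rlKernel α) (mul ℝ ℝ) volume = rlKernel (β + α) := by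
  rw [convolution_rlKernel (abs_rlKernel_le hβ) hα]
  ext x
  change _ = (Ioi (0 : ℝ)).indicator (normPow (β + α)) x
  by_cases hx : x ∈ Ioi (0 : ℝ)
  · rw [indicator_of_mem hx, indicator_of_mem hx, ← rlInt_normPow hβ hα.le hx]
    exact rlInt_congr_Ioo hα (le_of_lt hx) fun s hs => indicator_of_mem (mem_Ioi.2 hs.1) _
  · simp [indicator_of_notMem hx]

/-- Associativity of convolution (Fubini) moves the two kernels together, and their convolution is
the kernel of order `β + α` by the Beta integral. The kernels are nonnegative, so the absolute
integrability required is again existence of such convolutions. -/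
lemma rlInt_rlInt_of_bound (hFm : Measurable F)
    (hF : ∀ s, |F s| ≤ M * (Ioi (0 : ℝ)).indicator (fun s => s ^ (-μ)) s) (hμ : μ < 1)
    (hα : 0 < α) (hβ : 0 < β) (hx : 0 < x) :
    rlInt α (rlInt β F) x = rlInt (β + α) F x := by
  have hn : ∀ γ, 0 < γ → (fun s => ‖rlKernel γ s‖) = rlKernel γ := fun γ hγ => by
    ext s; exact Real.norm_of_nonneg (rlKernel_nonneg hγ s)
  have key := convolution_assoc (mul ℝ ℝ) (mul ℝ ℝ) (mul ℝ ℝ) (mul ℝ ℝ) (μ := volume) (ν := volume)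
    (f := F) (g := rlKernel β) (k := rlKernel α) (x₀ := x)
    (fun a b c => by simp [mul_assoc]) hFm.aestronglyMeasurable
    (measurable_rlKernel β).aestronglyMeasurable (measurable_rlKernel α).aestronglyMeasurable
    (Eventually.of_forall fun y => convolutionExistsAt_rlKernel hFm hF hμ hβ)
    (Eventually.of_forall fun y => by
      rw [hn α hα, hn β hβ]
      exact convolutionExistsAt_rlKernel (measurable_rlKernel β) (abs_rlKernel_le hβ)
        (by linarith) hα)
    (by
      rw [hn α hα, hn β hβ, convolution_rlKernel_rlKernel hα hβ]
      exact convolutionExistsAt_rlKernel hFm.norm (fun s => by simpa using hF s) hμ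
        (by linarith))
  rw [convolution_rlKernel_rlKernel hα hβ, convolution_rlKernel (β := β + α) hF (by linarith),
    indicator_of_mem (show x ∈ Ioi (0 : ℝ) from hx)] at key
  rw [← key, convolution_rlKernel hF hβ]
  unfold convolution
  simp only [ContinuousLinearMap.mul_apply']
  rw [rlInt_of_pos hα, intervalIntegral.integral_of_le hx.le, integral_Ioc_eq_integral_Ioo,
    ← integral_const_mul, ← integral_indicator measurableSet_Ioo]
  congr 1
  ext s
  by_cases hs : s ∈ Ioo 0 x
  · rw [indicator_of_mem hs, rlKernel, indicator_of_mem (show x - s ∈ Ioi (0 : ℝ) from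
      sub_pos.2 hs.2), indicator_of_mem (show s ∈ Ioi (0 : ℝ) from hs.1), normPow]
    ring
  · rw [indicator_of_notMem hs]
    by_cases h0 : s ∈ Ioi (0 : ℝ)
    · have : x - s ∉ Ioi (0 : ℝ) := fun h => hs ⟨h0, sub_pos.1 h⟩
      rw [rlKernel, indicator_of_notMem this, mul_zero]
    · rw [indicator_of_notMem h0, zero_mul]

end semigroup

/-! ### Mapping properties and exponential weights. -/

section

variable {T μ t α β : ℝ} {f : ℝ → ℝ}

lemma rlInt_rlInt (hT : 0 < T) (hf : MemC μ T f) (hμ : μ < 1) (hα : 0 ≤ α) (hβ : 0 ≤ β) :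
    EqOn (rlInt α (rlInt β f)) (rlInt (β + α) f) (Ioc 0 T) := by
  intro t ht
  rcases hα.eq_or_lt with rfl | hα
  · simp [rlInt_zero_order]
  rcases hβ.eq_or_lt with rfl | hβ
  · simp [rlInt_zero_order]
  obtain ⟨M, -, F, hFm, hF, hb⟩ := hf.exists_extension hT
  rw [← rlInt_congr (by linarith) hF ht, ← rlInt_rlInt_of_bound hFm hb hμ hα hβ ht.1]
  exact rlInt_congr hα.le (rlInt_congr hβ.le hF.symm) ht

/-- The substitution s = t x turns t^{μ-β} I^β f(t) into an integral over the fixed interval `[0,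
1]` with an integrable weight, continuous in t by dominated convergence. The exponent `μ - β` may be
negative and then records decay at 0. -/
lemma MemC.rlInt (hT : 0 < T) (hf : MemC μ T f) (hμ : μ < 1) (hβ : 0 ≤ β) :
    MemC (μ - β) T (rlInt β f) := by
  rcases hβ.eq_or_lt with rfl | hβ
  · simpa [rlInt_zero_order] using hf
  obtain ⟨k, hk, hk'⟩ := hf
  obtain ⟨M, hM⟩ := isCompact_Icc.exists_bound_of_continuousOn hk
  have hkc : Continuous fun s => k (projIcc 0 T hT.le s) :=
    (continuousOn_iff_continuous_domRestrict.1 hk).comp continuous_projIcc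
  have hI := intervalIntegrable_sub_rpow_mul_rpow hβ hμ one_pos
  refine ⟨fun t => 1 / Real.Gamma β * ∫ x in (0 : ℝ)..1,
    ((1 - x) ^ (β - 1) * x ^ (-μ)) * k (projIcc 0 T hT.le (t * x)), ?_, ?_⟩
  · refine (continuous_const.mul ?_).continuousOn
    refine intervalIntegral.continuous_of_dominated_interval
      (bound := fun x => (1 - x) ^ (β - 1) * x ^ (-μ) * M) ?_ ?_ (hI.mul_const M) ?_
    · intro t
      refine Measurable.aestronglyMeasurable ?_
      exact (((measurable_const.sub measurable_id).pow_const _).mul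
        (measurable_id.pow_const _)).mul (hkc.measurable.comp (measurable_const.mul measurable_id))
    · intro t
      refine Eventually.of_forall fun x hx => ?_
      rw [uIoc_of_le zero_le_one] at hx
      have : 0 ≤ (1 - x) ^ (β - 1) * x ^ (-μ) :=
        mul_nonneg (Real.rpow_nonneg (sub_nonneg.2 hx.2) _) (Real.rpow_nonneg hx.1.le _)
      rw [norm_mul, Real.norm_of_nonneg this]
      exact mul_le_mul_of_nonneg_left (hM _ (projIcc 0 T hT.le (t * x)).2) this
    · refine Eventually.of_forall fun x _ => ?_
      exact continuous_const.mul (hkc.comp (continuous_id.mul continuous_const))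
  · intro t ht
    have h1 := intervalIntegral.smul_integral_comp_mul_left
      (a := 0) (b := 1) (fun s => (t - s) ^ (β - 1) * f s) t
    rw [mul_zero, mul_one] at h1
    rw [rlInt_of_pos hβ, ← h1, smul_eq_mul]
    rw [mul_left_comm (t ^ (μ - β)), ← mul_assoc (t ^ (μ - β))]
    simp only
    congr 1
    rw [← intervalIntegral.integral_const_mul]
    rw [intervalIntegral.integral_of_le zero_le_one, intervalIntegral.integral_of_le zero_le_one]
    refine setIntegral_congr_fun measurableSet_Ioc fun x hx => ?_
    have hx0 : 0 < t * x := mul_pos ht.1 hx.1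
    have hxt : t * x ≤ t := mul_le_of_le_one_right ht.1.le hx.2
    rw [projIcc_of_mem hT.le ⟨hx0.le, hxt.trans ht.2⟩, hk' _ ⟨hx0, hxt.trans ht.2⟩,
      show t - t * x = t * (1 - x) by ring, Real.mul_rpow ht.1.le (sub_nonneg.2 hx.2),
      Real.mul_rpow ht.1.le hx.1.le, Real.rpow_sub ht.1 μ β, Real.rpow_sub ht.1 β 1,
      Real.rpow_one, Real.rpow_neg hx.1.le]
    have := (Real.rpow_pos_of_pos ht.1 β).ne'
    have := (Real.rpow_pos_of_pos hx.1 μ).ne'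
    have := ht.1.ne'
    field_simp

/-- Exponential weights make the Riemann-Liouville integral arbitrarily small. -/
lemma exists_abs_rlInt_le_exp (hT : 0 < T) (hμ : μ < 1) (hβ : 0 < β) {ε : ℝ} (hε : 0 < ε) :
    ∃ Λ, ∀ l, Λ ≤ l → ∀ (f : ℝ → ℝ) (M t : ℝ), 0 ≤ M → t ∈ Ioc 0 T →
      (∀ s ∈ Ioo 0 t, |f s| ≤ M * Real.exp (l * s) * s ^ (-μ)) →
      |rlInt β f t| ≤ ε * (M * Real.exp (l * t) * t ^ (-μ)) := by
  -- The inequality e^{-z} ≤ z^{-θ} at z = l(t - s) trades a part θ of the kernel's order for the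
  -- small factor l^{-θ}. The condition θ < β keeps the kernel integrable; θ ≤ 1 gives z^θ ≤ z + 1 ≤
  -- e^z.
  obtain ⟨θ, hθ0, hθ1, hθβ⟩ : ∃ θ : ℝ, 0 < θ ∧ θ ≤ 1 ∧ θ < β :=
    ⟨min 1 (β / 2), by positivity, min_le_left _ _, (min_le_right _ _).trans_lt (by linarith)⟩
  have hβ' : 0 < β - θ := by linarith
  have hG := Real.Gamma_pos_of_pos hβ
  have hG1 := Real.Gamma_pos_of_pos hβ'
  have hG2 := Real.Gamma_pos_of_pos (sub_pos.2 hμ)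
  have hG3 : 0 < Real.Gamma (1 - μ + (β - θ)) := Real.Gamma_pos_of_pos (by linarith)
  set D := 1 / Real.Gamma β * (T ^ (β - θ) *
    (Real.Gamma (1 - μ) * Real.Gamma (β - θ) / Real.Gamma (1 - μ + (β - θ)))) with hD
  have hD0 : 0 < D := by
    have := Real.rpow_pos_of_pos hT (β - θ)
    positivity
  have hlim : Tendsto (fun l : ℝ => l ^ (-θ) * D) atTop (𝓝 0) := by
    simpa using (tendsto_rpow_neg_atTop hθ0).mul_const D
  obtain ⟨Λ, hΛ⟩ := eventually_atTop.1 ((hlim.eventually (gt_mem_nhds hε)).and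
    (eventually_gt_atTop 0))
  refine ⟨Λ, fun l hl f M t hM ht hf => ?_⟩
  obtain ⟨hlε, hl0⟩ := hΛ l hl
  have hb := abs_integral_le_of_le_rpow (F := fun s => (t - s) ^ (β - 1) * f s)
    (C := M * Real.exp (l * t) * l ^ (-θ)) hβ' hμ ht.1 ?_
  · rw [rlInt_of_pos hβ, abs_mul, abs_of_pos (by positivity)]
    refine (mul_le_mul_of_nonneg_left hb (by positivity)).trans ?_
    have hsplit : t ^ (β - θ - μ) = t ^ (β - θ) * t ^ (-μ) := by
      rw [← Real.rpow_add ht.1]; ring_nf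
    have hmono : t ^ (β - θ) ≤ T ^ (β - θ) := Real.rpow_le_rpow ht.1.le ht.2 hβ'.le
    have h1 := Real.rpow_pos_of_pos ht.1 (-μ)
    have h2 := Real.rpow_pos_of_pos hl0 (-θ)
    calc _ = (M * Real.exp (l * t) * t ^ (-μ)) * (l ^ (-θ) * (1 / Real.Gamma β * (t ^ (β - θ) *
            (Real.Gamma (1 - μ) * Real.Gamma (β - θ) / Real.Gamma (1 - μ + (β - θ)))))) := by
          rw [hsplit]; ring
      _ ≤ (M * Real.exp (l * t) * t ^ (-μ)) * (l ^ (-θ) * D) := by rw [hD]; gcongr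
      _ ≤ (M * Real.exp (l * t) * t ^ (-μ)) * ε := by gcongr
      _ = _ := by ring
  · intro s hs
    have hts : 0 < t - s := sub_pos.2 hs.2
    have h0 : 0 ≤ (t - s) ^ (β - 1) := Real.rpow_nonneg hts.le _
    have hs0 := Real.rpow_pos_of_pos hs.1 (-μ)
    have hz : 0 < l * (t - s) := mul_pos hl0 hts
    have hexp : Real.exp (-(l * (t - s))) ≤ (l * (t - s)) ^ (-θ) := by
      rw [Real.exp_neg, Real.rpow_neg hz.le]
      refine inv_anti₀ (Real.rpow_pos_of_pos hz _) ?_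
      have h1 : (l * (t - s)) ^ θ ≤ l * (t - s) + 1 :=
        (Real.rpow_le_rpow hz.le (by linarith) hθ0.le).trans
          (Real.rpow_le_self_of_one_le (by linarith) hθ1)
      exact h1.trans (Real.add_one_le_exp _)
    have e1 : Real.exp (l * s) = Real.exp (l * t) * Real.exp (-(l * (t - s))) := by
      rw [← Real.exp_add]; ring_nf
    have e2 : (t - s) ^ (β - θ - 1) = (t - s) ^ (β - 1) * (t - s) ^ (-θ) := by
      rw [← Real.rpow_add hts]; ring_nf
    rw [abs_mul, abs_of_nonneg h0, e2]
    calc (t - s) ^ (β - 1) * |f s|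
        ≤ (t - s) ^ (β - 1) * (M * (Real.exp (l * t) * Real.exp (-(l * (t - s)))) * s ^ (-μ)) := by
          rw [← e1]; gcongr; exact hf s hs
      _ ≤ (t - s) ^ (β - 1) * (M * (Real.exp (l * t) * (l * (t - s)) ^ (-θ)) * s ^ (-μ)) := by
          gcongr
      _ = _ := by rw [Real.mul_rpow hl0.le hts.le]; ring

end

/-! ### Differentiating fractional integrals. -/

section

variable {T μ t β : ℝ} {f g : ℝ → ℝ}

lemma hasDerivWithinAt_rlInt_one (hT : 0 < T) (hf : MemC μ T f) (hμ : μ < 1) (ht : t ∈ Icc 0 T)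
    (hc : ContinuousWithinAt f (Icc 0 T) t) :
    HasDerivWithinAt (rlInt 1 f) (f t) (Icc 0 T) t := by
  have e : rlInt 1 f = fun u => ∫ s in (0 : ℝ)..u, f s := by ext u; exact rlInt_one
  have hi : IntervalIntegrable f volume 0 t := by
    simpa using hf.intervalIntegrable hT hμ one_pos ht
  have hm : StronglyMeasurableAtFilter f (𝓝[Icc 0 T] t) volume := by
    refine ⟨Icc 0 T, self_mem_nhdsWithin, ?_⟩
    rw [← Measure.restrict_congr_set Ioc_ae_eq_Icc]
    exact hf.continuousOn.aestronglyMeasurable measurableSet_Ioc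
  have : Fact (t ∈ Icc 0 T) := ⟨ht⟩
  rw [e]
  exact intervalIntegral.integral_hasDerivWithinAt_right hi hm hc

lemma MemC.continuousWithinAt (hf : MemC μ T f) (ht : t ∈ Ioc 0 T) :
    ContinuousWithinAt f (Icc 0 T) t := by
  refine (hf.continuousOn t ht).mono_of_mem_nhdsWithin ?_
  have : Ioc 0 T = Icc 0 T ∩ Ioi 0 := by
    ext x
    simp only [mem_Ioc, mem_inter_iff, mem_Icc, mem_Ioi]
    constructor
    · rintro ⟨h1, h2⟩; exact ⟨⟨h1.le, h2⟩, h1⟩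
    · rintro ⟨⟨_, h2⟩, h3⟩; exact ⟨h3, h2⟩
  rw [this]
  exact inter_mem self_mem_nhdsWithin (mem_nhdsWithin_of_mem_nhds (Ioi_mem_nhds ht.1))

lemma continuousOn_rlInt (hT : 0 < T) (hf : MemC μ T f) (hμ : μ < 1) (hβ : 0 < β) (h : μ < β) :
    ContinuousOn (rlInt β f) (Icc 0 T) := by
  obtain ⟨k, hk, hk'⟩ := hf.rlInt hT hμ hβ.le
  refine ((Real.continuous_rpow_const (q := β - μ) (by linarith)).continuousOn.mul hk).congr ?_
  intro t ht
  rcases ht.1.eq_or_lt with rfl | ht0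
  · simp [rlInt_at_zero hβ, Real.zero_rpow (sub_pos.2 h).ne']
  · rw [Pi.mul_apply, hk' t ⟨ht0, ht.2⟩]
    rw [← mul_assoc, ← Real.rpow_add ht0]
    simp

lemma rlInt_add_one (hT : 0 < T) (hf : MemC μ T f) (hμ : μ < 1) (hβ : 0 ≤ β) :
    EqOn (rlInt (β + 1) f) (rlInt 1 (rlInt β f)) (Icc 0 T) := by
  intro t ht
  rcases ht.1.eq_or_lt with rfl | ht0
  · rw [rlInt_at_zero one_pos, rlInt_at_zero (by linarith)]
  · exact (rlInt_rlInt hT hf hμ zero_le_one hβ ⟨ht0, ht.2⟩).symm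

lemma hasDerivWithinAt_rlInt_add_one (hT : 0 < T) (hf : MemC μ T f) (hμ : μ < 1) (hβ : 0 ≤ β)
    (ht : t ∈ Icc 0 T) (hc : ContinuousWithinAt (rlInt β f) (Icc 0 T) t) :
    HasDerivWithinAt (rlInt (β + 1) f) (rlInt β f t) (Icc 0 T) t :=
  (hasDerivWithinAt_rlInt_one hT (hf.rlInt hT hμ hβ) (by linarith) ht hc).congr
    (rlInt_add_one hT hf hμ hβ) (rlInt_add_one hT hf hμ hβ ht)

lemma iteratedDerivWithin_rlInt_Ioc (hT : 0 < T) (hf : MemC μ T f) (hμ : μ < 1) (n l : ℕ) :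
    EqOn (iteratedDerivWithin l (rlInt ((n + l : ℕ) : ℝ) f) (Ioc 0 T)) (rlInt n f) (Ioc 0 T) := by
  induction l generalizing n with
  | zero => intro t _; simp
  | succ l ih =>
    intro t ht
    rw [iteratedDerivWithin_succ]
    have h1 := ih (n + 1)
    rw [show n + 1 + l = n + (l + 1) by ring] at h1
    rw [derivWithin_congr h1 (h1 ht)]
    have h2 := hasDerivWithinAt_rlInt_add_one hT hf hμ (Nat.cast_nonneg n) ⟨ht.1.le, ht.2⟩
      ((hf.rlInt hT hμ (Nat.cast_nonneg n)).continuousWithinAt ht)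
    push_cast
    exact (h2.mono Ioc_subset_Icc_self).derivWithin (uniqueDiffOn_Ioc 0 T t ht)

lemma rlDeriv_congr {α : ℝ} (h : EqOn f g (Ioc 0 T)) :
    EqOn (rlDeriv T α f) (rlDeriv T α g) (Ioc 0 T) :=
  iteratedDerivWithin_congr (rlInt_congr (sub_nonneg.2 (Nat.le_ceil α)) h)

/-- With n = ⌈α⌉ the semigroup law gives I^{n-α} I^α f = I^n f, and n differentiations undo I^n on
`(0, T]`. -/
lemma rlDeriv_rlInt {α : ℝ} (hT : 0 < T) (hf : MemC μ T f) (hμ : μ < 1) (hα : 0 ≤ α) :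
    EqOn (rlDeriv T α (rlInt α f)) f (Ioc 0 T) := by
  intro t ht
  have h1 := rlInt_rlInt hT hf hμ (sub_nonneg.2 (Nat.le_ceil α)) hα
  rw [add_sub_cancel] at h1
  rw [rlDeriv, iteratedDerivWithin_congr h1 ht]
  have := iteratedDerivWithin_rlInt_Ioc hT hf hμ 0 ⌈α⌉₊ ht
  simpa [rlInt_zero_order] using this

/-- A function is determined on `[0, T]` by its value at `0` and its derivative inside. -/
lemma eqOn_of_hasDerivWithinAt {f' : ℝ → ℝ} (hf : ContinuousOn f (Icc 0 T))
    (hg : ContinuousOn g (Icc 0 T)) (h0 : f 0 = g 0)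
    (hf' : ∀ t ∈ Ioo 0 T, HasDerivWithinAt f (f' t) (Icc 0 T) t)
    (hg' : ∀ t ∈ Ioo 0 T, HasDerivWithinAt g (f' t) (Icc 0 T) t) : EqOn f g (Icc 0 T) := by
  intro t ht
  have h1 := intervalIntegral.integral_eq_sub_of_hasDerivAt_of_le (f := fun s => f s - g s)
    (f' := fun _ => 0) ht.1 ((hf.sub hg).mono (Icc_subset_Icc_right ht.2)) ?_ (by simp)
  · simp only [intervalIntegral.integral_zero, h0, sub_self, sub_zero] at h1
    linarith
  · intro s hs
    have hs' : s ∈ Ioo 0 T := ⟨hs.1, hs.2.trans_le ht.2⟩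
    have := ((hf' s hs').sub (hg' s hs')).hasDerivAt (Icc_mem_nhds hs'.1 hs'.2)
    rwa [sub_self] at this

end

/-! ### Taylor representation of C^n_γ. -/

section taylor

/-- The polynomial `∑_{k < n} b_k t ^ k / k!`. -/
noncomputable def taylorSum (n : ℕ) (b : ℕ → ℝ) (t : ℝ) : ℝ := ∑ k ∈ Finset.range n, b k * Phi k t

lemma Phi_eq_normPow (k : ℕ) (t : ℝ) : Phi k t = normPow (k + 1) t := by
  rw [Phi, normPow, add_sub_cancel_right, Real.rpow_natCast, Real.Gamma_nat_eq_factorial]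

lemma hasDerivAt_Phi_succ (k : ℕ) (t : ℝ) : HasDerivAt (Phi (k + 1)) (Phi k t) t := by
  have h := (hasDerivAt_pow (k + 1) t).div_const ((k + 1).factorial : ℝ)
  refine h.congr_deriv ?_
  rw [Phi, Nat.factorial_succ]
  have : (k.factorial : ℝ) ≠ 0 := by positivity
  push_cast
  field_simp

lemma hasDerivAt_taylorSum (n : ℕ) (b : ℕ → ℝ) (t : ℝ) :
    HasDerivAt (taylorSum (n + 1) b) (taylorSum n (fun k => b (k + 1)) t) t := by
  have e : taylorSum (n + 1) b = fun t => ∑ k ∈ Finset.range n, b (k + 1) * Phi (k + 1) t + b 0 := by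
    ext t
    simp [taylorSum, Finset.sum_range_succ', Phi]
  rw [e]
  exact (HasDerivAt.fun_sum fun k _ => (hasDerivAt_Phi_succ k t).const_mul _).add_const _

lemma continuous_taylorSum (n : ℕ) (b : ℕ → ℝ) : Continuous (taylorSum n b) := by
  unfold taylorSum Phi
  fun_prop

lemma taylorSum_zero (n : ℕ) (b : ℕ → ℝ) : taylorSum (n + 1) b 0 = b 0 := by
  simp [taylorSum, Finset.sum_range_succ', Phi]

variable {T γ t : ℝ} {v y : ℝ → ℝ} {b : ℕ → ℝ} {n : ℕ}

/-- At `n = 0` the integrand is `v` itself, which may be singular at 0; hence the alternative `n ≠ 0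
∨ 0 < t`. -/
lemma hasDerivWithinAt_taylorSum_add_rlInt (hT : 0 < T) (hv : MemC γ T v) (hγ : γ < 1)
    (ht : t ∈ Icc 0 T) (h : n ≠ 0 ∨ 0 < t) :
    HasDerivWithinAt (fun s => taylorSum (n + 1) b s + rlInt ((n + 1 : ℕ) : ℝ) v s)
      (taylorSum n (fun k => b (k + 1)) t + rlInt n v t) (Icc 0 T) t := by
  push_cast
  refine (hasDerivAt_taylorSum n b t).hasDerivWithinAt.add
    (hasDerivWithinAt_rlInt_add_one hT hv hγ (Nat.cast_nonneg n) ht ?_)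
  rcases h with h | h
  · have h1 : (1 : ℝ) ≤ n := by exact_mod_cast Nat.one_le_iff_ne_zero.2 h
    exact continuousOn_rlInt hT hv hγ (by linarith) (by linarith) t ht
  · exact (hv.rlInt hT hγ (Nat.cast_nonneg n)).continuousWithinAt ⟨h, ht.2⟩

lemma iteratedDerivWithin_taylorSum_add_rlInt (hT : 0 < T) (hv : MemC γ T v) (hγ : γ < 1) (l : ℕ)
    (hn : n ≠ 0) (hy : EqOn y (fun t => taylorSum (n + l) b t + rlInt ((n + l : ℕ) : ℝ) v t)
      (Icc 0 T)) :
    EqOn (iteratedDerivWithin l y (Icc 0 T))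
      (fun t => taylorSum n (fun k => b (k + l)) t + rlInt n v t) (Icc 0 T) := by
  induction l generalizing n with
  | zero => simpa using hy
  | succ l ih =>
    intro t ht
    have h1 := ih (n := n + 1) (by simp) (by rwa [show n + 1 + l = n + (l + 1) by ring])
    rw [iteratedDerivWithin_succ, derivWithin_congr h1 (h1 ht)]
    rw [(hasDerivWithinAt_taylorSum_add_rlInt hT hv hγ ht (Or.inl hn)).derivWithin
      (uniqueDiffOn_Icc hT t ht)]
    simp only [add_right_comm _ 1 l, add_assoc]

lemma hasDerivWithinAt_iteratedDerivWithin_taylorSum_add_rlInt (hT : 0 < T) (hv : MemC γ T v)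
    (hγ : γ < 1)
    (hy : EqOn y (fun t => taylorSum (n + 1) b t + rlInt ((n + 1 : ℕ) : ℝ) v t) (Icc 0 T))
    (ht : t ∈ Ioc 0 T) :
    HasDerivWithinAt (iteratedDerivWithin n y (Icc 0 T)) (v t) (Icc 0 T) t := by
  have ht' : t ∈ Icc 0 T := ⟨ht.1.le, ht.2⟩
  have h1 := iteratedDerivWithin_taylorSum_add_rlInt (n := 1) hT hv hγ n one_ne_zero
    (by rwa [add_comm 1 n])
  have h2 := hasDerivWithinAt_taylorSum_add_rlInt (n := 0) (b := fun k => b (k + n)) hT hv hγ ht'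
    (Or.inr ht.1)
  have h3 := h2.congr h1 (h1 ht')
  simpa [taylorSum, rlInt_zero_order] using h3

lemma iteratedDerivWithin_self_taylorSum_add_rlInt (hT : 0 < T) (hv : MemC γ T v) (hγ : γ < 1)
    (hn : n ≠ 0) (hy : EqOn y (fun t => taylorSum n b t + rlInt n v t) (Icc 0 T)) :
    EqOn (iteratedDerivWithin n y (Icc 0 T)) v (Ioc 0 T) := by
  obtain ⟨n, rfl⟩ := Nat.exists_eq_succ_of_ne_zero hn
  intro t ht
  rw [iteratedDerivWithin_succ]
  exact (hasDerivWithinAt_iteratedDerivWithin_taylorSum_add_rlInt hT hv hγ hy ht).derivWithin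
    (uniqueDiffOn_Icc hT t ⟨ht.1.le, ht.2⟩)

lemma iteratedDerivWithin_lt_taylorSum_add_rlInt (hT : 0 < T) (hv : MemC γ T v) (hγ : γ < 1)
    {l : ℕ} (hl : l < n) (hy : EqOn y (fun t => taylorSum n b t + rlInt n v t) (Icc 0 T)) :
    EqOn (iteratedDerivWithin l y (Icc 0 T))
      (fun t => taylorSum (n - l) (fun k => b (k + l)) t + rlInt ((n - l : ℕ) : ℝ) v t)
      (Icc 0 T) :=
  iteratedDerivWithin_taylorSum_add_rlInt hT hv hγ l (Nat.sub_ne_zero_of_lt hl)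
    (by rwa [Nat.sub_add_cancel hl.le])

lemma derivAtZero_taylorSum_add_rlInt (hT : 0 < T) (hv : MemC γ T v) (hγ : γ < 1)
    {l : ℕ} (hl : l < n) (hy : EqOn y (fun t => taylorSum n b t + rlInt n v t) (Icc 0 T)) :
    derivAtZero T l y = b l := by
  have hpos : (0 : ℝ) < ((n - l : ℕ) : ℝ) := by exact_mod_cast Nat.sub_pos_of_lt hl
  rw [derivAtZero, iteratedDerivWithin_lt_taylorSum_add_rlInt hT hv hγ hl hy ⟨le_rfl, hT.le⟩]
  simp only [rlInt_at_zero hpos]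
  obtain ⟨k, hk⟩ := Nat.exists_eq_succ_of_ne_zero (Nat.sub_ne_zero_of_lt hl)
  rw [hk, taylorSum_zero]
  simp

lemma memCn_taylorSum_add_rlInt (hT : 0 < T) (hv : MemC γ T v) (hγ : γ < 1)
    (hn : n ≠ 0) (hy : EqOn y (fun t => taylorSum n b t + rlInt n v t) (Icc 0 T)) :
    MemCn γ T n y := by
  have hself := iteratedDerivWithin_self_taylorSum_add_rlInt hT hv hγ hn hy
  obtain ⟨n, rfl⟩ := Nat.exists_eq_succ_of_ne_zero hn
  refine ⟨?_, fun t ht => ?_, hv.congr hself.symm⟩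
  · rw [contDiffOn_nat_iff_continuousOn_differentiableOn_deriv (uniqueDiffOn_Icc hT)]
    constructor
    · intro l hl
      have hpos : (1 : ℝ) ≤ ((n + 1 - l : ℕ) : ℝ) := by exact_mod_cast (by omega)
      refine ContinuousOn.congr ?_ (iteratedDerivWithin_lt_taylorSum_add_rlInt hT hv hγ
        (Nat.lt_succ_of_le hl) hy)
      exact (continuous_taylorSum _ _).continuousOn.add
        (continuousOn_rlInt hT hv hγ (by linarith) (by linarith))
    · intro l hl t ht
      have h1 := iteratedDerivWithin_lt_taylorSum_add_rlInt hT hv hγ (hl.trans n.lt_succ_self) hy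
      have h2 := hasDerivWithinAt_taylorSum_add_rlInt (n := n - l) (b := fun k => b (k + l))
        hT hv hγ ht (Or.inl (by omega))
      rw [show n - l + 1 = n.succ - l by omega] at h2
      exact (h2.congr h1 (h1 ht)).differentiableWithinAt
  · exact (hasDerivWithinAt_iteratedDerivWithin_taylorSum_add_rlInt hT hv hγ hy
      ht).differentiableWithinAt

/-- Taylor's formula with `v` the n-th derivative; it is the converse of
`memCn_taylorSum_add_rlInt`. -/
lemma MemCn.eqOn_taylorSum_add_rlInt (hT : 0 < T) (hγ : γ < 1) (hn : n ≠ 0)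
    (hy : MemCn γ T n y) :
    ∃ v, MemC γ T v ∧
      EqOn y (fun t => taylorSum n (fun k => derivAtZero T k y) t + rlInt n v t) (Icc 0 T) := by
  obtain ⟨n, rfl⟩ := Nat.exists_eq_succ_of_ne_zero hn
  obtain ⟨hc, hd, hv⟩ := hy
  refine ⟨_, hv, ?_⟩
  set v := iteratedDerivWithin (n + 1) y (Icc 0 T) with hvdef
  rw [contDiffOn_nat_iff_continuousOn_differentiableOn_deriv (uniqueDiffOn_Icc hT)] at hc
  -- Induction downwards from the highest continuous derivative: at each order both sides agree at 0
  -- and have the same derivative inside.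
  have key : ∀ l ≤ n, EqOn (iteratedDerivWithin (n - l) y (Icc 0 T)) (fun t =>
      taylorSum (l + 1) (fun k => derivAtZero T (k + (n - l)) y) t +
        rlInt ((l + 1 : ℕ) : ℝ) v t) (Icc 0 T) := by
    intro l
    induction l with
    | zero =>
      intro _
      refine eqOn_of_hasDerivWithinAt (f' := v) (hc.1 _ (Nat.sub_le _ _)) ?_ ?_ ?_ ?_
      · exact (continuous_taylorSum _ _).continuousOn.add
          (continuousOn_rlInt hT hv hγ (by simp) (by simpa using hγ))
      · rw [taylorSum_zero, rlInt_at_zero (by simp)]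
        simp [derivAtZero]
      · intro t ht
        rw [hvdef, iteratedDerivWithin_succ]
        exact (hd t ⟨ht.1, ht.2.le⟩).hasDerivWithinAt
      · intro t ht
        have := hasDerivWithinAt_taylorSum_add_rlInt (n := 0)
          (b := fun k => derivAtZero T (k + (n - 0)) y) hT hv hγ ⟨ht.1.le, ht.2.le⟩ (Or.inr ht.1)
        simpa [taylorSum, rlInt_zero_order] using this
    | succ l ih =>
      intro hl
      have ih := ih (by omega)
      have hpos : (1 : ℝ) ≤ ((l + 1 + 1 : ℕ) : ℝ) := by exact_mod_cast (by omega)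
      refine eqOn_of_hasDerivWithinAt (f' := iteratedDerivWithin (n - l) y (Icc 0 T))
        (hc.1 _ (Nat.sub_le _ _)) ?_ ?_ ?_ ?_
      · exact (continuous_taylorSum _ _).continuousOn.add
          (continuousOn_rlInt hT hv hγ (by linarith) (by linarith))
      · rw [taylorSum_zero, rlInt_at_zero (by linarith)]
        simp [derivAtZero]
      · intro t ht
        have := (hc.2 (n - (l + 1)) (by omega) t ⟨ht.1.le, ht.2.le⟩).hasDerivWithinAt
        rwa [← iteratedDerivWithin_succ, show n - (l + 1) + 1 = n - l by omega] at this
      · intro t ht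
        have ht' : t ∈ Icc 0 T := ⟨ht.1.le, ht.2.le⟩
        have := hasDerivWithinAt_taylorSum_add_rlInt (n := l + 1)
          (b := fun k => derivAtZero T (k + (n - (l + 1))) y) hT hv hγ ht' (Or.inr ht.1)
        rw [ih ht']
        refine this.congr_deriv ?_
        simp only [show ∀ k, k + 1 + (n - (l + 1)) = k + (n - l) by omega]
  simpa using key n le_rfl

end taylor

/-! ### Products with C^1_γ coefficients. -/

section product

variable {T γ μ t : ℝ} {a z : ℝ → ℝ}

lemma MemCn.exists_hasDerivWithinAt (ha : MemCn γ T 1 a) :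
    ContinuousOn a (Icc 0 T) ∧ ∃ a', MemC γ T a' ∧
      ∀ t ∈ Ioc 0 T, HasDerivWithinAt a (a' t) (Icc 0 T) t := by
  obtain ⟨h1, h2, h3⟩ := ha
  refine ⟨h1.continuousOn, _, h3, fun t ht => ?_⟩
  have := (h2 t ht).hasDerivWithinAt
  rw [← iteratedDerivWithin_succ] at this
  simpa using this

/-- Product rule: the product vanishes at 0 and is the integral of its derivative. Integrating z
gains one power of t, so the singularity of a' only leads to the exponent γ + μ - 1, still below 1.
-/
lemma mul_rlInt_one {a' : ℝ → ℝ} (hT : 0 < T) (hγ : γ < 1) (hμ : μ < 1)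
    (hac : ContinuousOn a (Icc 0 T)) (ha' : MemC γ T a')
    (had : ∀ t ∈ Ioc 0 T, HasDerivWithinAt a (a' t) (Icc 0 T) t) (hz : MemC μ T z) :
    MemC (max μ (γ + μ - 1)) T (fun t => a' t * rlInt 1 z t + a t * z t) ∧
    EqOn (fun t => a t * rlInt 1 z t) (rlInt 1 fun t => a' t * rlInt 1 z t + a t * z t)
      (Icc 0 T) := by
  have hm : MemC (max μ (γ + μ - 1)) T (fun t => a' t * rlInt 1 z t + a t * z t) := by
    refine MemC.add ((ha'.mul (hz.rlInt hT hμ zero_le_one)).mono ?_)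
      (((memC_zero_of_continuousOn hac).mul hz).mono ?_)
    · exact (by linarith : γ + (μ - 1) ≤ γ + μ - 1).trans (le_max_right _ _)
    · simp
  have hmax : max μ (γ + μ - 1) < 1 := max_lt hμ (by linarith)
  refine ⟨hm, eqOn_of_hasDerivWithinAt (f' := fun t => a' t * rlInt 1 z t + a t * z t) ?_ ?_ ?_ ?_ ?_⟩
  · exact hac.mul (continuousOn_rlInt hT hz hμ one_pos hμ)
  · exact continuousOn_rlInt hT hm hmax one_pos hmax
  · simp [rlInt_at_zero]
  · intro t ht
    have ht' : t ∈ Ioc 0 T := ⟨ht.1, ht.2.le⟩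
    exact (had t ht').mul (hasDerivWithinAt_rlInt_one hT hz hμ ⟨ht.1.le, ht.2.le⟩
      (hz.continuousWithinAt ht'))
  · intro t ht
    exact hasDerivWithinAt_rlInt_one hT hm hmax ⟨ht.1.le, ht.2.le⟩
      (hm.continuousWithinAt ⟨ht.1, ht.2.le⟩)

lemma eqOn_const_add_rlInt_one {a' : ℝ → ℝ} (hT : 0 < T) (hγ : γ < 1)
    (hac : ContinuousOn a (Icc 0 T)) (ha' : MemC γ T a')
    (had : ∀ t ∈ Ioc 0 T, HasDerivWithinAt a (a' t) (Icc 0 T) t) :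
    EqOn a (fun t => a 0 + rlInt 1 a' t) (Icc 0 T) := by
  refine eqOn_of_hasDerivWithinAt (f' := a') hac ?_ ?_ ?_ ?_
  · exact continuousOn_const.add (continuousOn_rlInt hT ha' hγ one_pos hγ)
  · simp [rlInt_at_zero]
  · exact fun t ht => had t ⟨ht.1, ht.2.le⟩
  · intro t ht
    exact (hasDerivWithinAt_rlInt_one hT ha' hγ ⟨ht.1.le, ht.2.le⟩
      (ha'.continuousWithinAt ⟨ht.1, ht.2.le⟩)).const_add _

end product

/-! ### Caputo derivatives and reduction to an integral equation. -/

section caputo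

variable {T γ α₀ t : ℝ} {n m : ℕ} {v y : ℝ → ℝ} {b : ℕ → ℝ} {α : ℕ → ℝ} {a : ℕ → ℝ → ℝ}

lemma rlDeriv_Phi {β : ℝ} {k : ℕ} (hT : 0 < T) (hβ : 0 ≤ β) (hk : β ≤ k) :
    EqOn (rlDeriv T β (Phi k)) (normPow (k - β + 1)) (Ioc 0 T) := by
  have h1 : EqOn (Phi k) (rlInt β (normPow (k - β + 1))) (Ioc 0 T) := fun t ht => by
    rw [rlInt_normPow (by linarith) hβ ht.1, Phi_eq_normPow]
    ring_nf
  exact (rlDeriv_congr h1).trans (rlDeriv_rlInt hT (memC_normPow _) (by linarith) hβ)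

lemma rlInt_order_eqOn (hT : 0 < T) (hγ0 : 0 ≤ γ) (hγ : γ < 1) (hα₀ : 0 < α₀) (hn : γ + α₀ = n)
    (hv : MemC γ T v) : EqOn (rlInt α₀ (rlInt γ v)) (rlInt n v) (Icc 0 T) := by
  intro t ht
  rcases ht.1.eq_or_lt with rfl | ht0
  · rw [rlInt_at_zero hα₀, rlInt_at_zero (by linarith)]
  · rw [rlInt_rlInt hT hv hγ hα₀.le hγ0 ⟨ht0, ht.2⟩, hn]

/-- The Caputo correction removes the monomials of degree below β. What remains is an I^β: each
monomial of degree k ≥ β is I^β of a normalised power, and I^n v = I^β I^{α₀-β} I^γ v. Then D^β I^β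
is the identity. -/
lemma caputoDeriv_eq {β : ℝ} (hT : 0 < T) (hγ0 : 0 ≤ γ) (hγ : γ < 1) (hn : γ + α₀ = n)
    (hv : MemC γ T v) (hy : EqOn y (fun t => taylorSum n b t + rlInt n v t) (Icc 0 T))
    (hβ : 0 ≤ β) (hβα : β ≤ α₀) :
    EqOn (caputoDeriv T β y) (fun t => ∑ k ∈ Finset.range n with β ≤ (k : ℕ),
      b k * normPow (k - β + 1) t + rlInt (α₀ - β) (rlInt γ v) t) (Ioc 0 T) := by
  set S : ℝ → ℝ := fun t => ∑ k ∈ Finset.range n with β ≤ (k : ℕ), b k * normPow (k - β + 1) t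
    with hS
  have hmS : MemC 0 T S := MemC.sum fun k hk => by
    refine ((memC_normPow _).const_mul (b k)).mono ?_
    have := (Finset.mem_filter.1 hk).2
    linarith
  have hmu : MemC 0 T (rlInt γ v) := by simpa using hv.rlInt hT hγ hγ0
  have hmI : MemC 0 T (rlInt (α₀ - β) (rlInt γ v)) :=
    (hmu.rlInt hT one_pos (by linarith)).mono (by linarith)
  have hceil : ⌈β⌉₊ ≤ n := Nat.ceil_le.2 (by linarith)
  have h1 : EqOn (fun s => y s - ∑ k ∈ Finset.range ⌈β⌉₊,
      derivAtZero T k y / (k.factorial : ℝ) * s ^ k)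
      (rlInt β fun t => S t + rlInt (α₀ - β) (rlInt γ v) t) (Ioc 0 T) := by
    intro t ht
    have ht' : t ∈ Icc 0 T := ⟨ht.1.le, ht.2⟩
    have e1 : ∑ k ∈ Finset.range ⌈β⌉₊, derivAtZero T k y / (k.factorial : ℝ) * t ^ k =
        ∑ k ∈ Finset.range n with ¬ β ≤ (k : ℕ), b k * Phi k t := by
      have : (Finset.range n).filter (fun k : ℕ => ¬ β ≤ (k : ℕ)) = Finset.range ⌈β⌉₊ := by
        ext k
        simp only [Finset.mem_filter, Finset.mem_range, not_le, Nat.lt_ceil]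
        exact ⟨fun h => h.2, fun h => ⟨(Nat.lt_ceil.2 h).trans_le hceil, h⟩⟩
      rw [this]
      refine Finset.sum_congr rfl fun k hk => ?_
      rw [derivAtZero_taylorSum_add_rlInt hT hv hγ ((Finset.mem_range.1 hk).trans_le hceil) hy, Phi]
      ring
    have e2 : rlInt β S t = ∑ k ∈ Finset.range n with β ≤ (k : ℕ), b k * Phi k t := by
      rw [hS, rlInt_sum (μ := 0) hT (fun k hk => ?_) one_pos hβ ht']
      · refine Finset.sum_congr rfl fun k hk => ?_
        have := (Finset.mem_filter.1 hk).2
        rw [rlInt_const_mul, rlInt_normPow (by linarith) hβ ht.1, Phi_eq_normPow]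
        ring_nf
      · refine ((memC_normPow _).const_mul (b k)).mono ?_
        have := (Finset.mem_filter.1 hk).2
        linarith
    have hyt : y t = taylorSum n b t + rlInt n v t := hy ht'
    simp only
    rw [rlInt_add hT hmS hmI one_pos hβ ht', e2, e1, hyt,
      rlInt_rlInt hT hmu one_pos hβ (by linarith) ht, sub_add_cancel, taylorSum,
      ← Finset.sum_filter_add_sum_filter_not (Finset.range n) (fun k : ℕ => β ≤ (k : ℕ))]
    have hα₀ : 0 ≤ α₀ := hβ.trans hβα
    rw [rlInt_rlInt hT hv hγ hα₀ hγ0 ht, hn]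
    ring
  exact (rlDeriv_congr h1).trans (rlDeriv_rlInt hT (hmS.add hmI) one_pos hβ)

/-- The orders decrease, so `α i ≤ j` holds exactly from the first such index on. Non-emptiness
ensures that this minimum is attained. -/
lemma Icc_h_eq_filter (hα : StrictAntiOn α (Set.Icc 0 m)) {j : ℕ} (hα_nonneg : ∀ i ≤ m, 0 ≤ α i)
    (hH : (H m α j).Nonempty) :
    Finset.Icc (h m α j) m = (Finset.Icc 1 m).filter fun i => α i ≤ j := by
  obtain ⟨h1, h2, -, h4⟩ := Nat.sInf_mem hH
  ext i
  simp only [Finset.mem_Icc, Finset.mem_filter]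
  constructor
  · rintro ⟨hi1, hi2⟩
    refine ⟨⟨h1.trans hi1, hi2⟩, ?_⟩
    exact (hα.antitoneOn ⟨Nat.zero_le _, h2⟩ ⟨Nat.zero_le _, hi2⟩ hi1).trans h4
  · rintro ⟨⟨hi1, hi2⟩, hi3⟩
    exact ⟨Nat.sInf_le ⟨hi1, hi2, hα_nonneg i hi2, hi3⟩, hi2⟩

lemma source_eq (hT : 0 < T) (hα : StrictAntiOn α (Set.Icc 0 m)) {j : ℕ}
    (hα_nonneg : ∀ i ≤ m, 0 ≤ α i) (hH : (H m α j).Nonempty) :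
    EqOn (source T m α a j) (fun t => ∑ i ∈ Finset.Icc 1 m with α i ≤ j,
      a i t * normPow (j - α i + 1) t) (Ioc 0 T) := by
  intro t ht
  simp only [source]
  rw [Icc_h_eq_filter hα hα_nonneg hH]
  refine Finset.sum_congr rfl fun i hi => ?_
  simp only [Finset.mem_filter, Finset.mem_Icc] at hi
  rw [rlDeriv_Phi hT (hα_nonneg i hi.1.2) hi.2 ht]

/-- In terms of `u = I^γ v`, the fractional equation is an integral equation. -/
lemma solvesEq_iff (hT : 0 < T) (hα : StrictAntiOn α (Set.Icc 0 m))
    (hα_nonneg : ∀ i ≤ m, 0 ≤ α i) (hH : ∀ j, (H m α j).Nonempty) (hγ0 : 0 ≤ γ) (hγ : γ < 1)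
    (hceil : ⌈α 0⌉₊ = n) (hn : γ + α 0 = n) (hv : MemC γ T v)
    (hy : EqOn y (fun t => taylorSum n b t + rlInt n v t) (Icc 0 T)) :
    SolvesEq T m α a y ↔ ∀ t ∈ Ioo 0 T, rlInt γ v t =
      -(opK m α a (rlInt γ v) t + ∑ k ∈ Finset.range n, b k * source T m α a k t) := by
  refine forall₂_congr fun t ht => ?_
  have ht' : t ∈ Ioc 0 T := ⟨ht.1, ht.2.le⟩
  have e0 : caputoDeriv T (α 0) y t = rlInt γ v t := by
    rw [caputoDeriv_eq hT hγ0 hγ hn hv hy (hα_nonneg 0 (Nat.zero_le _)) le_rfl ht']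
    -- All Taylor monomials have degree below ⌈α_0⌉, hence below α_0, and are removed.
    have : (Finset.range n).filter (fun k : ℕ => α 0 ≤ (k : ℕ)) = ∅ := by
      refine Finset.filter_eq_empty_iff.2 fun k hk => ?_
      rw [Finset.mem_range, ← hceil, Nat.lt_ceil] at hk
      linarith
    simp [this, rlInt_zero_order]
  have e1 : ∑ i ∈ Finset.Icc 1 m, a i t * caputoDeriv T (α i) y t =
      opK m α a (rlInt γ v) t + ∑ k ∈ Finset.range n, b k * source T m α a k t := by
    have : ∀ i ∈ Finset.Icc 1 m, a i t * caputoDeriv T (α i) y t =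
        a i t * rlInt (α 0 - α i) (rlInt γ v) t + ∑ k ∈ Finset.range n,
          if α i ≤ k then b k * (a i t * normPow (k - α i + 1) t) else 0 := by
      intro i hi
      rw [Finset.mem_Icc] at hi
      rw [caputoDeriv_eq hT hγ0 hγ hn hv hy (hα_nonneg i hi.2)
        (hα.antitoneOn ⟨le_rfl, Nat.zero_le _⟩ ⟨Nat.zero_le _, hi.2⟩ (Nat.zero_le _)) ht']
      simp only
      rw [mul_add, add_comm, Finset.mul_sum, Finset.sum_filter]
      congr 1
      refine Finset.sum_congr rfl fun k _ => ?_
      split_ifs <;> ring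
    rw [Finset.sum_congr rfl this, Finset.sum_add_distrib, Finset.sum_comm, opK]
    congr 1
    refine Finset.sum_congr rfl fun k _ => ?_
    rw [source_eq hT hα hα_nonneg (hH k) ht', ← Finset.sum_filter, Finset.mul_sum]
  rw [e0, e1]

end caputo

/-! ### Functions with a weakly singular derivative. -/

section prim

variable {T c d : ℝ} {u w : ℝ → ℝ}

/-- `u = c + ∫₀ᵗ w` on `(0, T]` with `w` in some weighted space `C_μ`, `μ < 1`. -/
def HasPrim (T c : ℝ) (u : ℝ → ℝ) : Prop :=
  ∃ μ < 1, ∃ w, MemC μ T w ∧ EqOn u (fun t => c + rlInt 1 w t) (Ioc 0 T)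

lemma HasPrim.congr (hu : HasPrim T c u) (h : EqOn w u (Ioc 0 T)) : HasPrim T c w := by
  obtain ⟨μ, hμ, z, hz, hz'⟩ := hu
  exact ⟨μ, hμ, z, hz, h.trans hz'⟩

lemma HasPrim.add (hT : 0 < T) (hu : HasPrim T c u) (hw : HasPrim T d w) :
    HasPrim T (c + d) (fun t => u t + w t) := by
  obtain ⟨μ, hμ, z, hz, hz'⟩ := hu
  obtain ⟨ν, hν, x, hx, hx'⟩ := hw
  have hm := max_lt hμ hν
  replace hz := hz.mono (le_max_left μ ν)
  replace hx := hx.mono (le_max_right μ ν)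
  refine ⟨max μ ν, hm, _, hz.add hx, fun t ht => ?_⟩
  simp only
  rw [rlInt_add hT hz hx hm zero_le_one ⟨ht.1.le, ht.2⟩, hz' ht, hx' ht]
  ring

lemma hasPrim_zero : HasPrim T 0 (fun _ => 0) :=
  ⟨0, one_pos, fun _ => 0, memC_zero, fun t _ => by simp [rlInt_zero_fun]⟩

lemma HasPrim.sum (hT : 0 < T) {ι : Type*} {s : Finset ι} {U : ι → ℝ → ℝ} {C : ι → ℝ}
    (hU : ∀ i ∈ s, HasPrim T (C i) (U i)) : HasPrim T (∑ i ∈ s, C i) (fun t => ∑ i ∈ s, U i t) := by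
  classical
  induction s using Finset.induction_on with
  | empty => simpa using hasPrim_zero
  | insert i s hi ih =>
    simp only [Finset.sum_insert hi]
    exact (hU i (by simp)).add hT (ih fun j hj => hU j (by simp [hj]))

lemma normPow_one (t : ℝ) : normPow 1 t = 1 := by simp [normPow]

lemma hasPrim_normPow {p : ℝ} (hp : 1 ≤ p) : HasPrim T (if p = 1 then 1 else 0) (normPow p) := by
  rcases hp.eq_or_lt with rfl | hp
  · exact ⟨0, one_pos, fun _ => 0, memC_zero, fun t _ => by simp [rlInt_zero_fun, normPow_one]⟩
  · refine ⟨1 - (p - 1), by linarith, normPow (p - 1), memC_normPow _, fun t ht => ?_⟩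
    beta_reduce
    rw [if_neg hp.ne', rlInt_normPow (by linarith) zero_le_one ht.1]
    simp

/-- I^β commutes with I^1 on the integral part, and the constant becomes c times the integral of the
kernel of order β. The value at 0 is therefore lost, which makes all iterates of K pure integrals.
-/
lemma HasPrim.rlInt {β : ℝ} (hT : 0 < T) (hβ : 0 < β) (hu : HasPrim T c u) :
    HasPrim T 0 (rlInt β u) := by
  obtain ⟨μ, hμ, w, hw, hw'⟩ := hu
  have h1 : HasPrim T 0 (CaputoFDE.rlInt 1 (CaputoFDE.rlInt β w)) :=
    ⟨μ - β, by linarith, _, hw.rlInt hT hμ hβ.le, fun t _ => by simp⟩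
  have h2 : HasPrim T 0 (fun t => c * CaputoFDE.rlInt 1 (normPow β) t) := by
    refine ⟨1 - β, by linarith, fun t => c * normPow β t, (memC_normPow _).const_mul _,
      fun t _ => ?_⟩
    simp [rlInt_const_mul]
  have h3 := h2.add hT h1
  rw [add_zero] at h3
  refine h3.congr fun t ht => ?_
  have hw1 : MemC 0 T (CaputoFDE.rlInt 1 w) := (hw.rlInt hT hμ zero_le_one).mono (by linarith)
  have hc : MemC 0 T (fun t => c * normPow 1 t) :=
    ((memC_normPow 1).const_mul c).mono (by simp)
  have e : EqOn u (fun t => c * normPow 1 t + CaputoFDE.rlInt 1 w t) (Ioc 0 T) := fun s hs => by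
    simp only [normPow_one, mul_one, hw' hs]
  beta_reduce
  rw [rlInt_congr hβ.le e ht, rlInt_add hT hc hw1 one_pos hβ.le ⟨ht.1.le, ht.2⟩, rlInt_const_mul,
    rlInt_normPow one_pos hβ.le ht.1, rlInt_normPow hβ zero_le_one ht.1,
    rlInt_rlInt hT hw hμ hβ.le zero_le_one ht, rlInt_rlInt hT hw hμ zero_le_one hβ.le ht,
    add_comm 1 β]

lemma HasPrim.mul {γ : ℝ} {a a' : ℝ → ℝ} (hT : 0 < T) (hγ : γ < 1)
    (hac : ContinuousOn a (Icc 0 T)) (ha' : MemC γ T a')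
    (had : ∀ t ∈ Ioc 0 T, HasDerivWithinAt a (a' t) (Icc 0 T) t) (hu : HasPrim T c u) :
    HasPrim T (a 0 * c) (fun t => a t * u t) := by
  obtain ⟨μ, hμ, w, hw, hw'⟩ := hu
  obtain ⟨h1, h2⟩ := mul_rlInt_one hT hγ hμ hac ha' had hw
  have h3 : HasPrim T 0 (fun t => a t * CaputoFDE.rlInt 1 w t) :=
    ⟨_, max_lt hμ (by linarith), _, h1, fun t ht => by
      simp only [zero_add]; exact h2 ⟨ht.1.le, ht.2⟩⟩
  have h4 : HasPrim T (a 0 * c) (fun t => a t * c) := by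
    refine ⟨γ, hγ, _, ha'.const_mul c, fun t ht => ?_⟩
    simp only
    rw [rlInt_const_mul, eqOn_const_add_rlInt_one hT hγ hac ha' had ⟨ht.1.le, ht.2⟩]
    ring
  have h5 := h4.add hT h3
  rw [add_zero] at h5
  refine h5.congr fun t ht => ?_
  simp only [hw' ht]
  ring

/-- The constant 1 is I^γ of t^{-γ}/Γ(1-γ), which lies in C_γ, and I^1 w = I^γ I^{1-γ} w with
I^{1-γ} w of exponent μ - (1 - γ) < γ. -/
lemma HasPrim.exists_rlInt_eq {γ : ℝ} (hT : 0 < T) (hγ0 : 0 ≤ γ) (hγ : γ < 1)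
    (hu : HasPrim T c u) : ∃ v, MemC γ T v ∧ EqOn (CaputoFDE.rlInt γ v) u (Ioc 0 T) := by
  obtain ⟨μ, hμ, w, hw, hw'⟩ := hu
  have h1 : MemC γ T (fun t => c * normPow (1 - γ) t) :=
    ((memC_normPow _).const_mul c).mono (by linarith)
  have h2 : MemC γ T (CaputoFDE.rlInt (1 - γ) w) :=
    (hw.rlInt hT hμ (by linarith)).mono (by linarith)
  refine ⟨_, h1.add h2, fun t ht => ?_⟩
  rw [rlInt_add hT h1 h2 hγ hγ0 ⟨ht.1.le, ht.2⟩, rlInt_const_mul,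
    rlInt_normPow (by linarith) hγ0 ht.1, rlInt_rlInt hT hw hμ hγ0 (by linarith) ht,
    sub_add_cancel, normPow_one, hw' ht, mul_one]

end prim

/-! ### The integral operator: contraction and iterates. -/

section

/-- The `a i`, `1 ≤ i ≤ m`, are `C^1_γ` functions with derivatives `a' i`. -/
structure HasCoeffDerivs (T γ : ℝ) (m : ℕ) (a a' : ℕ → ℝ → ℝ) : Prop where
  continuousOn : ∀ i ∈ Finset.Icc 1 m, ContinuousOn (a i) (Icc 0 T)
  memC : ∀ i ∈ Finset.Icc 1 m, MemC γ T (a' i)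
  hasDerivWithinAt : ∀ i ∈ Finset.Icc 1 m, ∀ t ∈ Ioc 0 T,
    HasDerivWithinAt (a i) (a' i t) (Icc 0 T) t

/-- The operator with `opK (∫₀ w) = ∫₀ (opL w)`. -/
noncomputable def opL (m : ℕ) (α : ℕ → ℝ) (a a' : ℕ → ℝ → ℝ) (w : ℝ → ℝ) (t : ℝ) : ℝ :=
  ∑ i ∈ Finset.Icc 1 m, (a' i t * rlInt 1 (rlInt (α 0 - α i) w) t + a i t * rlInt (α 0 - α i) w t)

variable {T γ μ c : ℝ} {m : ℕ} {α : ℕ → ℝ} {a a' : ℕ → ℝ → ℝ} {u w : ℝ → ℝ}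

lemma opK_congr (hα : ∀ i ∈ Finset.Icc 1 m, α i < α 0) (h : EqOn u w (Ioc 0 T)) :
    EqOn (opK m α a u) (opK m α a w) (Ioc 0 T) := fun t ht =>
  Finset.sum_congr rfl fun i hi => by rw [rlInt_congr (sub_nonneg.2 (hα i hi).le) h ht]

/-- Apply `mul_rlInt_one` to I^{α_0-α_i} w after commuting the integrals. The positive order absorbs
the loss of exponent, so L maps C_μ to itself and can be iterated. -/
lemma opK_rlInt_one (hT : 0 < T) (hγ : γ < 1) (hμ : μ < 1) (hα : ∀ i ∈ Finset.Icc 1 m, α i < α 0)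
    (ha : HasCoeffDerivs T γ m a a') (hw : MemC μ T w) :
    MemC μ T (opL m α a a' w) ∧
      EqOn (opK m α a (rlInt 1 w)) (rlInt 1 (opL m α a a' w)) (Ioc 0 T) := by
  have key : ∀ i ∈ Finset.Icc 1 m,
      MemC μ T (fun t => a' i t * rlInt 1 (rlInt (α 0 - α i) w) t + a i t * rlInt (α 0 - α i) w t) ∧
      EqOn (fun t => a i t * rlInt 1 (rlInt (α 0 - α i) w) t) (rlInt 1 fun t =>
        a' i t * rlInt 1 (rlInt (α 0 - α i) w) t + a i t * rlInt (α 0 - α i) w t) (Icc 0 T) := by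
    intro i hi
    have hβ := sub_pos.2 (hα i hi)
    obtain ⟨h1, h2⟩ := mul_rlInt_one hT hγ (by linarith) (ha.continuousOn i hi) (ha.memC i hi)
      (ha.hasDerivWithinAt i hi) (hw.rlInt hT hμ hβ.le)
    exact ⟨h1.mono (max_le (by linarith) (by linarith)), h2⟩
  refine ⟨MemC.sum fun i hi => (key i hi).1, fun t ht => ?_⟩
  have ht' : t ∈ Icc 0 T := ⟨ht.1.le, ht.2⟩
  unfold opL
  rw [rlInt_sum hT (fun i hi => (key i hi).1) hμ zero_le_one ht', opK]
  refine Finset.sum_congr rfl fun i hi => ?_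
  have hβ := (sub_pos.2 (hα i hi)).le
  rw [← (key i hi).2 ht']
  beta_reduce
  rw [rlInt_rlInt hT hw hμ hβ zero_le_one ht,
    rlInt_rlInt hT hw hμ zero_le_one hβ ht, add_comm 1]

lemma HasPrim.opK (hT : 0 < T) (hγ : γ < 1) (hα : ∀ i ∈ Finset.Icc 1 m, α i < α 0)
    (ha : HasCoeffDerivs T γ m a a') (hu : HasPrim T c u) : HasPrim T 0 (opK m α a u) := by
  have h := HasPrim.sum hT fun i hi => (hu.rlInt hT (sub_pos.2 (hα i hi))).mul hT hγ
    (ha.continuousOn i hi) (ha.memC i hi) (ha.hasDerivWithinAt i hi)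
  simp only [mul_zero, Finset.sum_const_zero] at h
  exact h

lemma exists_hasPrim_source (hT : 0 < T) (hγ : γ < 1) (hα : StrictAntiOn α (Set.Icc 0 m)) {j : ℕ}
    (hα_nonneg : ∀ i ≤ m, 0 ≤ α i) (hH : (H m α j).Nonempty) (ha : HasCoeffDerivs T γ m a a') :
    ∃ c, HasPrim T c (source T m α a j) := by
  refine ⟨_, HasPrim.congr (HasPrim.sum hT
    (C := fun i => a i 0 * if (j : ℝ) - α i + 1 = 1 then 1 else 0) fun i hi => ?_) (source_eq hT hα hα_nonneg hH)⟩
  rw [Finset.mem_filter] at hi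
  exact (hasPrim_normPow (by linarith [hi.2])).mul hT hγ (ha.continuousOn i hi.1) (ha.memC i hi.1)
    (ha.hasDerivWithinAt i hi.1)

/-- A weight exponent that works simultaneously for all orders `α 0 - α i`. -/
lemma exists_exp_weight (hT : 0 < T) (hμ : μ < 1) (hα : ∀ i ∈ Finset.Icc 1 m, α i < α 0) {ε : ℝ}
    (hε : 0 < ε) : ∃ l, 0 ≤ l ∧ ∀ i ∈ Finset.Icc 1 m, ∀ (f : ℝ → ℝ) (M t : ℝ), 0 ≤ M →
      t ∈ Ioc 0 T → (∀ s ∈ Ioo 0 t, |f s| ≤ M * Real.exp (l * s) * s ^ (-μ)) →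
      |rlInt (α 0 - α i) f t| ≤ ε * (M * Real.exp (l * t) * t ^ (-μ)) := by
  have h : ∀ i ∈ Finset.Icc 1 m, ∀ᶠ l : ℝ in atTop, ∀ (f : ℝ → ℝ) (M t : ℝ), 0 ≤ M →
      t ∈ Ioc 0 T → (∀ s ∈ Ioo 0 t, |f s| ≤ M * Real.exp (l * s) * s ^ (-μ)) →
      |rlInt (α 0 - α i) f t| ≤ ε * (M * Real.exp (l * t) * t ^ (-μ)) := fun i hi => by
    obtain ⟨Λ, hΛ⟩ := exists_abs_rlInt_le_exp hT hμ (sub_pos.2 (hα i hi)) hε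
    exact eventually_atTop.2 ⟨Λ, hΛ⟩
  obtain ⟨l, h1, h2⟩ := ((eventually_ge_atTop 0).and ((Finset.eventually_all _).2 h)).exists
  exact ⟨l, h1, h2⟩

lemma exists_pos_mul_le_half {D : ℝ} (hD : 0 ≤ D) : ∃ ε > 0, D * ε ≤ 1 / 2 := by
  refine ⟨1 / (2 * (D + 1)), by positivity, ?_⟩
  rw [mul_one_div, div_le_div_iff₀ (by positivity) two_pos]
  linarith

lemma exists_opL_contraction (hT : 0 < T) (hγ : γ < 1) (hμ : μ < 1)
    (hα : ∀ i ∈ Finset.Icc 1 m, α i < α 0) (ha : HasCoeffDerivs T γ m a a') :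
    ∃ l, 0 ≤ l ∧ ∀ (w : ℝ → ℝ) (M : ℝ), 0 ≤ M →
      (∀ s ∈ Ioc 0 T, |w s| ≤ M * Real.exp (l * s) * s ^ (-μ)) →
      ∀ t ∈ Ioc 0 T, |opL m α a a' w t| ≤ M * (1 / 2) * Real.exp (l * t) * t ^ (-μ) := by
  have hA : ∀ i ∈ Finset.Icc 1 m, ∃ A, 0 ≤ A ∧ ∀ t ∈ Ioc 0 T, |a i t| ≤ A := fun i hi => by
    obtain ⟨A, hA, hA'⟩ := (memC_zero_of_continuousOn (ha.continuousOn i hi)).exists_bound hT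
    exact ⟨A, hA, fun t ht => by simpa using hA' t ht⟩
  have hB : ∀ i ∈ Finset.Icc 1 m, ∃ B, 0 ≤ B ∧ ∀ t ∈ Ioc 0 T, |a' i t| ≤ B * t ^ (-γ) :=
    fun i hi => (ha.memC i hi).exists_bound hT
  choose! A hA0 hA using hA
  choose! B hB0 hB using hB
  have hG2 := Real.Gamma_pos_of_pos (sub_pos.2 hμ)
  have hG3 : 0 < Real.Gamma (1 - μ + 1) := Real.Gamma_pos_of_pos (by linarith)
  set D := Real.Gamma (1 - μ) / Real.Gamma (1 - μ + 1) with hD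
  have hD0 : 0 < D := by positivity
  have hT' := Real.rpow_pos_of_pos hT (1 - γ)
  -- The sum collects the bounds of all coefficients and of their derivatives, so that smallness ε
  -- of the weighted integrals yields the factor 1/2 for L.
  obtain ⟨ε, hε, hε'⟩ := exists_pos_mul_le_half
    (D := ∑ i ∈ Finset.Icc 1 m, (B i * (D * T ^ (1 - γ)) + A i))
    (Finset.sum_nonneg fun i hi => by have := hA0 i hi; have := hB0 i hi; positivity)
  obtain ⟨l, hl0, hl⟩ := exists_exp_weight hT hμ hα hε
  refine ⟨l, hl0, fun w M hM hw t ht => ?_⟩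
  have hr := Real.rpow_pos_of_pos ht.1 (-μ)
  have hrγ := Real.rpow_pos_of_pos ht.1 (-γ)
  have hI : ∀ i ∈ Finset.Icc 1 m, ∀ s ∈ Ioc 0 T,
      |rlInt (α 0 - α i) w s| ≤ ε * (M * Real.exp (l * s) * s ^ (-μ)) := fun i hi s hs =>
    hl i hi w M s hM hs fun x hx => hw x ⟨hx.1, hx.2.le.trans hs.2⟩
  have hJ : ∀ i ∈ Finset.Icc 1 m, |rlInt 1 (rlInt (α 0 - α i) w) t| ≤
      ε * (M * Real.exp (l * t)) * D * t ^ (1 - μ) := fun i hi => by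
    refine abs_rlInt_le one_pos hμ ht.1 fun s hs => ?_
    refine (hI i hi s ⟨hs.1, hs.2.le.trans ht.2⟩).trans ?_
    have := Real.rpow_pos_of_pos hs.1 (-μ)
    have h1 : Real.exp (l * s) ≤ Real.exp (l * t) :=
      Real.exp_le_exp.2 (mul_le_mul_of_nonneg_left hs.2.le hl0)
    rw [← mul_assoc]
    gcongr
  -- The additional integration in the term with a' compensates its singularity t^{-γ}.
  have hpow : t ^ (-γ) * t ^ (1 - μ) ≤ T ^ (1 - γ) * t ^ (-μ) := by
    have : t ^ (-γ) * t ^ (1 - μ) = t ^ (1 - γ) * t ^ (-μ) := by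
      rw [← Real.rpow_add ht.1, ← Real.rpow_add ht.1]; ring_nf
    rw [this]
    gcongr
    · exact ht.1.le
    · exact ht.2
  have hP : 0 ≤ M * Real.exp (l * t) := by positivity
  calc |opL m α a a' w t|
      ≤ ∑ i ∈ Finset.Icc 1 m, (M * Real.exp (l * t) * t ^ (-μ)) *
          ((B i * (D * T ^ (1 - γ)) + A i) * ε) := by
        refine (Finset.abs_sum_le_sum_abs _ _).trans (Finset.sum_le_sum fun i hi => ?_)
        refine (abs_add_le _ _).trans ?_
        rw [abs_mul, abs_mul]
        have hA1 := hA0 i hi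
        have hB1 := hB0 i hi
        calc _ ≤ (B i * t ^ (-γ)) * (ε * (M * Real.exp (l * t)) * D * t ^ (1 - μ)) +
              A i * (ε * (M * Real.exp (l * t) * t ^ (-μ))) := by
              gcongr
              · exact hB i hi t ht
              · exact hJ i hi
              · exact hA i hi t ht
              · exact hI i hi t ht
          _ = B i * (ε * (M * Real.exp (l * t)) * D) * (t ^ (-γ) * t ^ (1 - μ)) +
              A i * (ε * (M * Real.exp (l * t) * t ^ (-μ))) := by ring
          _ ≤ B i * (ε * (M * Real.exp (l * t)) * D) * (T ^ (1 - γ) * t ^ (-μ)) +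
              A i * (ε * (M * Real.exp (l * t) * t ^ (-μ))) := by gcongr
          _ = _ := by ring
    _ = (M * Real.exp (l * t) * t ^ (-μ)) *
          ((∑ i ∈ Finset.Icc 1 m, (B i * (D * T ^ (1 - γ)) + A i)) * ε) := by
        rw [← Finset.mul_sum, Finset.sum_mul]
    _ ≤ (M * Real.exp (l * t) * t ^ (-μ)) * (1 / 2) := by gcongr
    _ = _ := by ring

/-- The homogeneous integral equation has only the trivial bounded solution. -/
lemma eqOn_zero_of_eq_neg_opK (hT : 0 < T) (hα : ∀ i ∈ Finset.Icc 1 m, α i < α 0)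
    (ha : ∀ i ∈ Finset.Icc 1 m, ContinuousOn (a i) (Icc 0 T)) (hu : MemC 0 T u)
    (h : ∀ t ∈ Ioo 0 T, u t = -opK m α a u t) : ∀ t ∈ Ioo 0 T, u t = 0 := by
  have hA : ∀ i ∈ Finset.Icc 1 m, ∃ A, 0 ≤ A ∧ ∀ t ∈ Ioc 0 T, |a i t| ≤ A := fun i hi => by
    obtain ⟨A, hA, hA'⟩ := (memC_zero_of_continuousOn (ha i hi)).exists_bound hT
    exact ⟨A, hA, fun t ht => by simpa using hA' t ht⟩
  choose! A hA0 hA using hA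
  obtain ⟨ε, hε, hε'⟩ := exists_pos_mul_le_half (Finset.sum_nonneg hA0)
  obtain ⟨l, hl0, hl⟩ := exists_exp_weight (μ := 0) hT one_pos hα hε
  simp only [neg_zero, Real.rpow_zero, mul_one] at hl
  obtain ⟨M, hM, hb⟩ := hu.exists_bound hT
  have key : ∀ k : ℕ, ∀ t ∈ Ioo 0 T, |u t| ≤ M * (1 / 2) ^ k * Real.exp (l * t) := by
    intro k
    induction k with
    | zero =>
      intro t ht
      have h1 := hb t ⟨ht.1, ht.2.le⟩
      have h2 : 1 ≤ Real.exp (l * t) := Real.one_le_exp (mul_nonneg hl0 ht.1.le)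
      simp only [neg_zero, Real.rpow_zero, mul_one] at h1
      simp only [pow_zero, mul_one]
      exact h1.trans (le_mul_of_one_le_right hM h2)
    | succ k ih =>
      intro t ht
      have ht' : t ∈ Ioc 0 T := ⟨ht.1, ht.2.le⟩
      rw [h t ht, abs_neg]
      calc |opK m α a u t|
          ≤ ∑ i ∈ Finset.Icc 1 m, (M * (1 / 2) ^ k * Real.exp (l * t)) * (A i * ε) := by
            refine (Finset.abs_sum_le_sum_abs _ _).trans (Finset.sum_le_sum fun i hi => ?_)
            rw [abs_mul]
            have hA1 := hA0 i hi
            have hI := hl i hi u (M * (1 / 2) ^ k) t (by positivity) ht'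
              fun s hs => ih s ⟨hs.1, hs.2.trans ht.2⟩
            calc _ ≤ A i * (ε * (M * (1 / 2) ^ k * Real.exp (l * t))) := by
                  gcongr
                  exact hA i hi t ht'
              _ = _ := by ring
        _ = (M * (1 / 2) ^ k * Real.exp (l * t)) * ((∑ i ∈ Finset.Icc 1 m, A i) * ε) := by
            rw [← Finset.mul_sum, Finset.sum_mul]
        _ ≤ (M * (1 / 2) ^ k * Real.exp (l * t)) * (1 / 2) := by gcongr
        _ = _ := by ring
  intro t ht
  have hlim : Tendsto (fun k : ℕ => M * (1 / 2 : ℝ) ^ k * Real.exp (l * t)) atTop (𝓝 0) := by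
    simpa using ((tendsto_pow_atTop_nhds_zero_of_lt_one (r := (1 / 2 : ℝ)) (by norm_num)
      (by norm_num)).const_mul M).mul_const (Real.exp (l * t))
  exact abs_nonpos_iff.1 (ge_of_tendsto' hlim fun k => key k t ht)

/-- The iterates `K^k f` are of the form `I^γ v_k` with `v_k` decaying geometrically in `C_γ`. -/
lemma exists_rlInt_eq_iterate_opK {f : ℝ → ℝ} (hT : 0 < T) (hγ0 : 0 ≤ γ) (hγ : γ < 1)
    (hα : ∀ i ∈ Finset.Icc 1 m, α i < α 0) (ha : HasCoeffDerivs T γ m a a')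
    (hf : HasPrim T c f) :
    ∃ (v : ℕ → ℝ → ℝ) (M : ℝ), (∀ k, MemC γ T (v k)) ∧
      (∀ k, EqOn (rlInt γ (v k)) ((opK m α a)^[k] f) (Ioc 0 T)) ∧
      ∀ k, ∀ t ∈ Ioc 0 T, |v k t| ≤ M * (1 / 2) ^ k * t ^ (-γ) := by
  obtain ⟨v₀, hv₀, hv₀'⟩ := hf.exists_rlInt_eq hT hγ0 hγ
  obtain ⟨M₀, hM₀, hb₀⟩ := hv₀.exists_bound hT
  -- K f has constant 0, so from here on K^{k+1} f = I^1 L^k w. Only f itself needs a separate v_0.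
  obtain ⟨μ, hμ, w, hw, hw'⟩ := hf.opK (c := c) hT hγ hα ha
  simp only [zero_add] at hw'
  obtain ⟨l, hl0, hl⟩ := exists_opL_contraction hT hγ hμ hα ha
  obtain ⟨M₁, hM₁, hb₁⟩ := hw.exists_bound hT
  set L := opL m α a a' with hL
  have hmem : ∀ k, MemC μ T (L^[k] w) := fun k => by
    induction k with
    | zero => exact hw
    | succ k ih =>
      rw [Function.iterate_succ_apply']
      exact (opK_rlInt_one hT hγ hμ hα ha ih).1
  have heq : ∀ k, EqOn ((opK m α a)^[k + 1] f) (rlInt 1 (L^[k] w)) (Ioc 0 T) := fun k => by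
    induction k with
    | zero => exact hw'
    | succ k ih =>
      rw [Function.iterate_succ_apply', Function.iterate_succ_apply' L]
      exact (opK_congr hα ih).trans (opK_rlInt_one hT hγ hμ hα ha (hmem k)).2
  have hbd : ∀ k, ∀ t ∈ Ioc 0 T,
      |(L^[k] w) t| ≤ M₁ * (1 / 2) ^ k * Real.exp (l * t) * t ^ (-μ) := fun k => by
    induction k with
    | zero =>
      intro t ht
      have h2 : 1 ≤ Real.exp (l * t) := Real.one_le_exp (mul_nonneg hl0 ht.1.le)
      have := Real.rpow_pos_of_pos ht.1 (-μ)
      refine (hb₁ t ht).trans ?_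
      rw [pow_zero, mul_one]
      gcongr
      exact le_mul_of_one_le_right hM₁ h2
    | succ k ih =>
      intro t ht
      rw [Function.iterate_succ_apply', pow_succ, ← mul_assoc]
      exact hl _ _ (by positivity) ih t ht
  have hG2 := Real.Gamma_pos_of_pos (sub_pos.2 hμ)
  have hG3 : 0 < Real.Gamma (1 - μ + (1 - γ)) := Real.Gamma_pos_of_pos (by linarith)
  set D := Real.Gamma (1 - μ) / Real.Gamma (1 - μ + (1 - γ)) with hD
  have hD0 : 0 < D := by positivity
  set C := M₁ * Real.exp (l * T) * D * T ^ (1 - μ) with hC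
  have hTμ := Real.rpow_pos_of_pos hT (1 - μ)
  have hC0 : 0 ≤ C := by positivity
  -- v_{k+1} = I^{1-γ} L^k w. The factor 2 in the bound pays for the shift from (1/2)^k to
  -- (1/2)^{k+1}.
  refine ⟨fun k => Nat.casesOn k v₀ fun k => rlInt (1 - γ) (L^[k] w), M₀ + 2 * C, ?_, ?_, ?_⟩
  · rintro (_ | k)
    · exact hv₀
    · exact ((hmem k).rlInt hT hμ (by linarith)).mono (by linarith)
  · rintro (_ | k)
    · exact hv₀'
    · refine EqOn.trans ?_ (heq k).symm
      have := rlInt_rlInt hT (hmem k) hμ hγ0 (sub_nonneg.2 hγ.le)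
      rwa [sub_add_cancel] at this
  · rintro (_ | k) t ht
    · have := Real.rpow_pos_of_pos ht.1 (-γ)
      refine (hb₀ t ht).trans ?_
      rw [pow_zero, mul_one]
      gcongr
      linarith
    · have h1 : |rlInt (1 - γ) (L^[k] w) t| ≤
          M₁ * (1 / 2) ^ k * Real.exp (l * T) * D * t ^ (1 - γ - μ) := by
        refine abs_rlInt_le (by linarith) hμ ht.1 fun s hs => ?_
        refine (hbd k s ⟨hs.1, hs.2.le.trans ht.2⟩).trans ?_
        have := Real.rpow_pos_of_pos hs.1 (-μ)
        have h1 : Real.exp (l * s) ≤ Real.exp (l * T) :=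
          Real.exp_le_exp.2 (mul_le_mul_of_nonneg_left (hs.2.le.trans ht.2) hl0)
        gcongr
      have h2 : t ^ (1 - γ - μ) ≤ T ^ (1 - μ) * t ^ (-γ) := by
        have : t ^ (1 - γ - μ) = t ^ (1 - μ) * t ^ (-γ) := by
          rw [← Real.rpow_add ht.1]; ring_nf
        have := Real.rpow_pos_of_pos ht.1 (-γ)
        rw [‹t ^ (1 - γ - μ) = _›]
        gcongr
        · exact ht.1.le
        · exact ht.2
      have := Real.rpow_pos_of_pos ht.1 (-γ)
      calc _ ≤ M₁ * (1 / 2) ^ k * Real.exp (l * T) * D * (T ^ (1 - μ) * t ^ (-γ)) :=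
            h1.trans (by gcongr)
        _ = 2 * C * (1 / 2) ^ (k + 1) * t ^ (-γ) := by rw [hC, pow_succ]; ring
        _ ≤ (M₀ + 2 * C) * (1 / 2) ^ (k + 1) * t ^ (-γ) := by gcongr; linarith

end

/-! ### Summation of the Neumann series. -/

section

variable {T γ c β : ℝ} {m n : ℕ} {α : ℕ → ℝ} {a a' : ℕ → ℝ → ℝ} {b : ℕ → ℝ}

/-- Weierstrass M-test for the continuous extensions of t^γ v_k; their bounds pass to the point 0 by
density. -/
lemma exists_memC_tsum {v : ℕ → ℝ → ℝ} {M : ℝ} (hT : 0 < T) (hv : ∀ k, MemC γ T (v k))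
    (hb : ∀ k, ∀ t ∈ Ioc 0 T, |v k t| ≤ M * (1 / 2) ^ k * t ^ (-γ)) :
    ∃ V, MemC γ T V ∧ ∀ ε > 0, ∀ᶠ N in atTop, ∀ t ∈ Ioc 0 T,
      |V t - ∑ k ∈ Finset.range N, v k t| ≤ ε * t ^ (-γ) := by
  choose g hg hg' using hv
  have hsum : Summable fun k : ℕ => M * (1 / 2 : ℝ) ^ k :=
    (summable_geometric_of_lt_one (by norm_num) (by norm_num)).mul_left M
  have hcl : closure (Ioc 0 T) = Icc 0 T := closure_Ioc hT.ne
  have hgb : ∀ k, ∀ t ∈ Icc 0 T, ‖g k t‖ ≤ M * (1 / 2) ^ k := by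
    intro k t ht
    rw [← hcl] at ht
    refine le_on_closure (f := fun t => ‖g k t‖) (g := fun _ => M * (1 / 2) ^ k) (fun s hs => ?_)
      (by rw [hcl]; exact (hg k).norm) continuousOn_const ht
    have h1 := Real.rpow_pos_of_pos hs.1 γ
    rw [hg' k s hs, norm_mul, Real.norm_of_nonneg h1.le, Real.norm_eq_abs]
    calc s ^ γ * |v k s| ≤ s ^ γ * (M * (1 / 2) ^ k * s ^ (-γ)) := by
          gcongr; exact hb k s hs
      _ = M * (1 / 2) ^ k := by rw [Real.rpow_neg hs.1.le]; field_simp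
  refine ⟨fun t => t ^ (-γ) * ∑' k, g k t, ⟨fun t => ∑' k, g k t,
    continuousOn_tsum hg hsum hgb, fun t ht => ?_⟩, fun ε hε => ?_⟩
  · rw [← mul_assoc, ← Real.rpow_add ht.1]
    simp
  · filter_upwards [Metric.tendstoUniformlyOn_iff.1 (tendstoUniformlyOn_tsum_nat hsum hgb) ε hε]
      with N hN t ht
    have h1 := hN t ⟨ht.1.le, ht.2⟩
    have h2 := Real.rpow_pos_of_pos ht.1 (-γ)
    have h3 : ∑ k ∈ Finset.range N, v k t = t ^ (-γ) * ∑ k ∈ Finset.range N, g k t := by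
      rw [Finset.mul_sum]
      refine Finset.sum_congr rfl fun k _ => ?_
      rw [hg' k t ht, ← mul_assoc, ← Real.rpow_add ht.1]
      simp
    rw [h3, ← mul_sub, abs_mul, abs_of_pos h2, mul_comm]
    rw [Real.dist_eq] at h1
    gcongr

/-- I^β sends t^{-γ} to a multiple of t^{β-γ}, bounded on `(0, T]` because γ ≤ β. Order 0 occurs
only for γ = 0, where the hypothesis is already uniform convergence. -/
lemma tendstoUniformlyOn_rlInt {V : ℝ → ℝ} {S : ℕ → ℝ → ℝ} (hT : 0 < T) (hγ0 : 0 ≤ γ) (hγ : γ < 1)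
    (hβ : γ ≤ β) (hV : MemC γ T V) (hS : ∀ N, MemC γ T (S N))
    (h : ∀ ε > 0, ∀ᶠ N in atTop, ∀ t ∈ Ioc 0 T, |V t - S N t| ≤ ε * t ^ (-γ)) :
    TendstoUniformlyOn (fun N => rlInt β (S N)) (rlInt β V) atTop (Ioc 0 T) := by
  rw [Metric.tendstoUniformlyOn_iff]
  intro ε hε
  rcases (hγ0.trans hβ).eq_or_lt with rfl | hβ0
  · obtain rfl : γ = 0 := le_antisymm hβ hγ0
    filter_upwards [h (ε / 2) (by positivity)] with N hN t ht
    have := hN t ht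
    simp only [neg_zero, Real.rpow_zero, mul_one] at this
    rw [Real.dist_eq, rlInt_zero_order, rlInt_zero_order]
    linarith
  · have hG2 := Real.Gamma_pos_of_pos (sub_pos.2 hγ)
    have hG3 : 0 < Real.Gamma (1 - γ + β) := Real.Gamma_pos_of_pos (by linarith)
    have hT' := Real.rpow_pos_of_pos hT (β - γ)
    set D := Real.Gamma (1 - γ) / Real.Gamma (1 - γ + β) with hD
    have hD0 : 0 < D := by positivity
    filter_upwards [h (ε / (2 * (D * T ^ (β - γ)))) (by positivity)] with N hN t ht
    rw [Real.dist_eq, ← rlInt_sub hT hV (hS N) hγ hβ0.le ⟨ht.1.le, ht.2⟩]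
    have h1 := abs_rlInt_le (β := β) hβ0 hγ ht.1
      fun s hs => hN s ⟨hs.1, hs.2.le.trans ht.2⟩
    have h2 : t ^ (β - γ) ≤ T ^ (β - γ) := Real.rpow_le_rpow ht.1.le ht.2 (by linarith)
    calc _ ≤ _ := h1
      _ ≤ ε / (2 * (D * T ^ (β - γ))) * D * T ^ (β - γ) := by gcongr
      _ = ε / 2 := by field_simp
      _ < ε := by linarith

lemma tendstoUniformlyOn_rlInt_Icc {V : ℝ → ℝ} {S : ℕ → ℝ → ℝ} (hT : 0 < T) (hγ0 : 0 ≤ γ)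
    (hγ : γ < 1) (hβ : γ ≤ β) (hβ0 : 0 < β) (hV : MemC γ T V) (hS : ∀ N, MemC γ T (S N))
    (h : ∀ ε > 0, ∀ᶠ N in atTop, ∀ t ∈ Ioc 0 T, |V t - S N t| ≤ ε * t ^ (-γ)) :
    TendstoUniformlyOn (fun N => rlInt β (S N)) (rlInt β V) atTop (Icc 0 T) := by
  rw [Metric.tendstoUniformlyOn_iff]
  intro ε hε
  filter_upwards [Metric.tendstoUniformlyOn_iff.1
    (tendstoUniformlyOn_rlInt hT hγ0 hγ hβ hV hS h) ε hε] with N hN t ht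
  rcases ht.1.eq_or_lt with rfl | ht0
  · simpa [rlInt_at_zero hβ0] using hε
  · exact hN t ⟨ht0, ht.2⟩

lemma opK_sum {ι : Type*} {s : Finset ι} {C : ι → ℝ} {U : ι → ℝ → ℝ} {t : ℝ} (hT : 0 < T)
    (hα : ∀ i ∈ Finset.Icc 1 m, α i < α 0) (hU : ∀ j ∈ s, MemC 0 T (U j)) (ht : t ∈ Icc 0 T) :
    opK m α a (fun x => ∑ j ∈ s, C j * U j x) t = ∑ j ∈ s, C j * opK m α a (U j) t := by
  simp only [opK, Finset.mul_sum]
  rw [Finset.sum_comm]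
  refine Finset.sum_congr rfl fun i hi => ?_
  rw [rlInt_sum hT (fun j hj => (hU j hj).const_mul (C j)) one_pos (sub_pos.2 (hα i hi)).le ht,
    Finset.mul_sum]
  refine Finset.sum_congr rfl fun j _ => ?_
  rw [rlInt_const_mul]
  ring

/-- The Neumann series for the integral equation `u = -(K u + f)`, in terms of `u = I^γ V`. -/
lemma exists_neumann_series {f : ℝ → ℝ} (hT : 0 < T) (hγ0 : 0 ≤ γ) (hγ : γ < 1) (hα₀ : 0 < α 0)
    (hn : γ + α 0 = n) (hα : ∀ i ∈ Finset.Icc 1 m, α i < α 0) (ha : HasCoeffDerivs T γ m a a')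
    (hf : HasPrim T c f) :
    ∃ (v : ℕ → ℝ → ℝ) (V : ℝ → ℝ), (∀ k, MemC γ T (v k)) ∧ MemC γ T V ∧
      (∀ k, EqOn (fun t => (-1) ^ (k + 1) * rlInt (α 0) ((opK m α a)^[k] f) t) (rlInt n (v k))
        (Icc 0 T)) ∧
      (∀ ε > 0, ∀ᶠ N in atTop, ∀ t ∈ Ioc 0 T,
        |V t - ∑ k ∈ Finset.range N, v k t| ≤ ε * t ^ (-γ)) ∧
      (∀ t ∈ Icc 0 T, HasSum (fun k => rlInt n (v k) t) (rlInt n V t)) ∧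
      ∀ t ∈ Ioc 0 T, rlInt γ V t = -(opK m α a (rlInt γ V) t + f t) := by
  obtain ⟨v, M, hv, hvK, hb⟩ := exists_rlInt_eq_iterate_opK hT hγ0 hγ hα ha hf
  set w : ℕ → ℝ → ℝ := fun k t => (-1) ^ (k + 1) * v k t with hw
  have hwm : ∀ k, MemC γ T (w k) := fun k => (hv k).const_mul _
  have hwb : ∀ k, ∀ t ∈ Ioc 0 T, |w k t| ≤ M * (1 / 2) ^ k * t ^ (-γ) := fun k t ht => by
    rw [hw]
    simp only [abs_mul, abs_pow, abs_neg, abs_one, one_pow, one_mul]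
    exact hb k t ht
  obtain ⟨V, hV, htail⟩ := exists_memC_tsum hT hwm hwb
  have hSm : ∀ N, MemC γ T (fun t => ∑ k ∈ Finset.range N, w k t) :=
    fun N => MemC.sum fun k _ => hwm k
  have hn0 : (0 : ℝ) < n := by linarith
  have hm0 : ∀ {x}, MemC γ T x → MemC 0 T (rlInt γ x) := fun hx => by
    simpa using hx.rlInt hT hγ hγ0
  refine ⟨w, V, hwm, hV, fun k t ht => ?_, htail, fun t ht => ?_, fun t ht => ?_⟩
  · rw [hw]
    simp only [rlInt_const_mul]
    rw [← rlInt_order_eqOn hT hγ0 hγ hα₀ hn (hv k) ht, rlInt_congr_Icc hα₀ (hvK k) ht]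
  · have hlim := (tendstoUniformlyOn_rlInt_Icc hT hγ0 hγ (β := n) (by linarith) hn0 hV hSm
      htail).tendsto_at ht
    simp only [rlInt_sum hT (fun k _ => hwm k) hγ hn0.le ht] at hlim
    have hsum : Summable fun k => rlInt n (w k) t := by
      rcases ht.1.eq_or_lt with rfl | ht0
      · simp only [rlInt_at_zero hn0]
        exact summable_zero
      refine Summable.of_norm_bounded (g := fun k : ℕ => M * (1 / 2 : ℝ) ^ k *
        (Real.Gamma (1 - γ) / Real.Gamma (1 - γ + n)) * t ^ (n - γ)) ?_ fun k => ?_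
      · exact (((summable_geometric_of_lt_one (by norm_num) (by norm_num)).mul_left M).mul_right
          _).mul_right _
      · exact abs_rlInt_le hn0 hγ ht0 fun s hs => hwb k s ⟨hs.1, hs.2.le.trans ht.2⟩
    have := tendsto_nhds_unique hsum.hasSum.tendsto_sum_nat hlim
    rw [← this]
    exact hsum.hasSum
  · have ht' : t ∈ Icc 0 T := ⟨ht.1.le, ht.2⟩
    have e1 : ∀ N, rlInt γ (fun t => ∑ k ∈ Finset.range N, w k t) t =
        ∑ k ∈ Finset.range N, (-1) ^ (k + 1) * ((opK m α a)^[k] f) t := fun N => by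
      rw [rlInt_sum hT (fun k _ => hwm k) hγ hγ0 ht']
      refine Finset.sum_congr rfl fun k _ => ?_
      rw [hw]
      simp only [rlInt_const_mul, hvK k ht]
    have e2 : ∀ N, opK m α a (rlInt γ (fun t => ∑ k ∈ Finset.range N, w k t)) t =
        ∑ k ∈ Finset.range N, (-1) ^ (k + 1) * ((opK m α a)^[k + 1] f) t := fun N => by
      have : EqOn (rlInt γ (fun t => ∑ k ∈ Finset.range N, w k t))
          (fun t => ∑ k ∈ Finset.range N, (-1) ^ (k + 1) * rlInt γ (v k) t) (Ioc 0 T) :=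
        fun s hs => by
          rw [rlInt_sum hT (fun k _ => hwm k) hγ hγ0 ⟨hs.1.le, hs.2⟩]
          simp only [hw, rlInt_const_mul]
      rw [opK_congr hα this ht, opK_sum hT hα (fun k _ => hm0 (hv k)) ht']
      refine Finset.sum_congr rfl fun k _ => ?_
      rw [opK_congr hα (hvK k) ht, Function.iterate_succ_apply']
    -- The partial sums satisfy S_{N+1} = -(K S_N + f), with the term k = 0 giving -f. The limit of
    -- this recursion is the equation.
    have e3 : ∀ N, rlInt γ (fun t => ∑ k ∈ Finset.range (N + 1), w k t) t =
        -(opK m α a (rlInt γ (fun t => ∑ k ∈ Finset.range N, w k t)) t + f t) := fun N => by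
      rw [e1, e2, Finset.sum_range_succ', neg_add, ← Finset.sum_neg_distrib]
      congr 1
      · exact Finset.sum_congr rfl fun k _ => by rw [pow_succ _ (k + 1)]; ring
      · simp
    have l1 : Tendsto (fun N => rlInt γ (fun t => ∑ k ∈ Finset.range N, w k t) t) atTop
        (𝓝 (rlInt γ V t)) :=
      (tendstoUniformlyOn_rlInt hT hγ0 hγ le_rfl hV hSm htail).tendsto_at ht
    have l2 : Tendsto (fun N => opK m α a (rlInt γ (fun t => ∑ k ∈ Finset.range N, w k t)) t) atTop
        (𝓝 (opK m α a (rlInt γ V) t)) := by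
      unfold opK
      refine tendsto_finsetSum _ fun i hi => Tendsto.const_mul _ ?_
      have hβ := (sub_pos.2 (hα i hi)).le
      -- Merging the integrals gives order γ + (α_0 - α_i) ≥ γ, to which the uniform convergence
      -- applies.
      rw [rlInt_rlInt hT hV hγ hβ hγ0 ht]
      simp only [fun N => rlInt_rlInt hT (hSm N) hγ hβ hγ0 ht]
      exact (tendstoUniformlyOn_rlInt hT hγ0 hγ (by linarith) hV hSm htail).tendsto_at ht
    refine tendsto_nhds_unique (l1.comp (tendsto_add_atTop_nat 1)) ?_
    refine ((l2.add_const (f t)).neg).congr fun N => ?_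
    exact (e3 N).symm

/-- The Taylor parts cancel. Derivatives of order k < n differ by I^{n-k}(V - S_N), of order at
least 1 > γ, and the n-th derivatives by V - S_N itself, which is small after weighting by t^γ. -/
lemma tendstoCn_taylorSum_add_rlInt {V : ℝ → ℝ} {S : ℕ → ℝ → ℝ} {y : ℝ → ℝ} {Y : ℕ → ℝ → ℝ}
    (hT : 0 < T) (hγ0 : 0 ≤ γ) (hγ : γ < 1) (hn : n ≠ 0) (hV : MemC γ T V)
    (hS : ∀ N, MemC γ T (S N))
    (h : ∀ ε > 0, ∀ᶠ N in atTop, ∀ t ∈ Ioc 0 T, |V t - S N t| ≤ ε * t ^ (-γ))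
    (hy : EqOn y (fun t => taylorSum n b t + rlInt n V t) (Icc 0 T))
    (hY : ∀ N, EqOn (Y N) (fun t => taylorSum n b t + rlInt n (S N) t) (Icc 0 T)) :
    TendstoCn γ T n Y y := by
  constructor
  · intro k hk
    have h1 : (1 : ℝ) ≤ ((n - k : ℕ) : ℝ) := by exact_mod_cast Nat.sub_pos_of_lt hk
    rw [Metric.tendstoUniformlyOn_iff]
    intro ε hε
    filter_upwards [Metric.tendstoUniformlyOn_iff.1 (tendstoUniformlyOn_rlInt_Icc hT hγ0 hγ
      (β := ((n - k : ℕ) : ℝ)) (by linarith) (by linarith) hV hS h) ε hε] with N hN t ht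
    rw [iteratedDerivWithin_lt_taylorSum_add_rlInt hT hV hγ hk hy ht,
      iteratedDerivWithin_lt_taylorSum_add_rlInt hT (hS N) hγ hk (hY N) ht]
    simpa using hN t ht
  · rw [Metric.tendstoUniformlyOn_iff]
    intro ε hε
    filter_upwards [h (ε / 2) (by positivity)] with N hN t ht
    rw [iteratedDerivWithin_self_taylorSum_add_rlInt hT hV hγ hn hy ht,
      iteratedDerivWithin_self_taylorSum_add_rlInt hT (hS N) hγ hn (hY N) ht, Real.dist_eq,
      ← mul_sub, abs_mul]
    have h1 := Real.rpow_pos_of_pos ht.1 γ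
    rw [abs_of_pos h1]
    calc _ ≤ t ^ γ * (ε / 2 * t ^ (-γ)) := by gcongr; exact hN t ht
      _ = ε / 2 := by rw [Real.rpow_neg ht.1.le]; field_simp
      _ < ε := by linarith

lemma taylorSum_single {j : ℕ} (hj : j < n) (t : ℝ) :
    taylorSum n (fun k => if j = k then 1 else 0) t = Phi j t := by
  simp [taylorSum, hj]

end

end CaputoFDE

/-! ### The main theorem. -/

theorem corollary1 (T : ℝ) (hT : 0 < T) (m : ℕ) (α : ℕ → ℝ)
    (hα : StrictAntiOn α (Set.Icc 0 m)) (hα_nonneg : ∀ i ≤ m, 0 ≤ α i)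
    (a : ℕ → ℝ → ℝ) (γ : ℝ) (hγ : γ = (⌈α 0⌉₊ : ℝ) - α 0)
    (hn : ⌈α 0⌉₊ = ⌈α 1⌉₊)
    (ha : ∀ i ∈ Finset.Icc 1 m, CaputoFDE.MemCn γ T 1 (a i))
    (haD : ∀ i ∈ Finset.Icc 1 m, CaputoFDE.MemC 0 T (CaputoFDE.rlDeriv T γ (a i)))
    (hH : (CaputoFDE.H m α 0).Nonempty) :
    -- the series for `y_j` converges absolutely at every point and in the space `C_γ^{n_0}[0, T]`
    (∀ j < ⌈α 0⌉₊,
      (∀ t ∈ Set.Icc 0 T, Summable (fun k => CaputoFDE.seriesTerm T m α a j k t)) ∧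
      (∀ k, CaputoFDE.MemCn γ T ⌈α 0⌉₊ (CaputoFDE.seriesTerm T m α a j k)) ∧
      CaputoFDE.MemCn γ T ⌈α 0⌉₊ (CaputoFDE.ySeries T m α a j) ∧
      CaputoFDE.TendstoCn γ T ⌈α 0⌉₊
        (fun N t => CaputoFDE.Phi j t +
          ∑ k ∈ Finset.range N, CaputoFDE.seriesTerm T m α a j k t)
        (CaputoFDE.ySeries T m α a j)) ∧
    -- the `y_j` form a canonical fundamental system of solutions
    CaputoFDE.IsCanonicalSystem T m α a (CaputoFDE.ySeries T m α a) ∧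
    -- existence, representation and uniqueness for the initial value problem
    ∀ b : ℕ → ℝ,
      CaputoFDE.MemCn γ T ⌈α 0⌉₊
        (fun t => ∑ j ∈ Finset.range ⌈α 0⌉₊, b j * CaputoFDE.ySeries T m α a j t) ∧
      CaputoFDE.SolvesIVP T m α a b
        (fun t => ∑ j ∈ Finset.range ⌈α 0⌉₊, b j * CaputoFDE.ySeries T m α a j t) ∧
      ∀ y : ℝ → ℝ, CaputoFDE.MemCn γ T ⌈α 0⌉₊ y → CaputoFDE.SolvesIVP T m α a b y →
        Set.EqOn y (fun t => ∑ j ∈ Finset.range ⌈α 0⌉₊, b j * CaputoFDE.ySeries T m α a j t)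
          (Set.Icc 0 T) := by
  open CaputoFDE Set in
  have hαlt : ∀ i ∈ Finset.Icc 1 m, α i < α 0 := fun i hi => by
    rw [Finset.mem_Icc] at hi
    exact hα ⟨le_rfl, Nat.zero_le _⟩ ⟨Nat.zero_le _, hi.2⟩ hi.1
  have hα₀ : 0 < α 0 := by
    obtain ⟨i, h1, h2, h3, -⟩ := hH
    exact h3.trans_lt (hαlt i (Finset.mem_Icc.2 ⟨h1, h2⟩))
  -- An index with order at most 0 belongs to every H_j.
  have hHj : ∀ j, (H m α j).Nonempty := fun j => by
    obtain ⟨i, h1, h2, h3, h4⟩ := hH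
    exact ⟨i, h1, h2, h3, h4.trans (by simp)⟩
  have hγ0 : 0 ≤ γ := hγ ▸ sub_nonneg.2 (Nat.le_ceil _)
  have hγ1 : γ < 1 := by linarith [Nat.ceil_lt_add_one hα₀.le]
  have hnα : γ + α 0 = (⌈α 0⌉₊ : ℝ) := by rw [hγ]; ring
  have hnne : ⌈α 0⌉₊ ≠ 0 := (Nat.ceil_pos.2 hα₀).ne'
  obtain ⟨a', ha'⟩ : ∃ a', HasCoeffDerivs T γ m a a' := by
    choose! a' h1 h2 using fun i hi => (ha i hi).exists_hasDerivWithinAt.2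
    exact ⟨a', fun i hi => (ha i hi).exists_hasDerivWithinAt.1, h1, h2⟩
  clear hn haD hγ hH ha
  unfold IsCanonicalSystem SolvesIVP
  generalize hceil : ⌈α 0⌉₊ = n at hnα hnne ⊢
  have hn0 : (0 : ℝ) < n := by exact_mod_cast Nat.pos_of_ne_zero hnne
  have hm0 : ∀ {x}, MemC γ T x → MemC 0 T (rlInt γ x) := fun hx => by
    simpa using hx.rlInt hT hγ1 hγ0
  have hsol := fun {v y : ℝ → ℝ} {b : ℕ → ℝ} (hv : MemC γ T v) =>
    solvesEq_iff (a := a) (y := y) (b := b) hT hα hα_nonneg hHj hγ0 hγ1 hceil hnα hv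
  have hser : ∀ j, ∃ (v : ℕ → ℝ → ℝ) (V : ℝ → ℝ), (∀ k, MemC γ T (v k)) ∧ MemC γ T V ∧
      (∀ k, EqOn (seriesTerm T m α a j k) (rlInt n (v k)) (Icc 0 T)) ∧
      (∀ ε > 0, ∀ᶠ N in Filter.atTop, ∀ t ∈ Ioc 0 T,
        |V t - ∑ k ∈ Finset.range N, v k t| ≤ ε * t ^ (-γ)) ∧
      (∀ t ∈ Icc 0 T, HasSum (fun k => rlInt n (v k) t) (rlInt n V t)) ∧
      ∀ t ∈ Ioc 0 T, rlInt γ V t = -(opK m α a (rlInt γ V) t + source T m α a j t) := fun j => by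
    obtain ⟨c, hc⟩ := exists_hasPrim_source hT hγ1 hα hα_nonneg (hHj j) ha'
    exact exists_neumann_series hT hγ0 hγ1 hα₀ hnα hαlt ha' hc
  choose v V hv hV hterm htail hsum hVeq using hser
  have hy : ∀ j < n, EqOn (ySeries T m α a j) (fun t =>
      taylorSum n (fun k => if j = k then 1 else 0) t + rlInt n (V j) t) (Icc 0 T) := by
    intro j hj t ht
    simp only [ySeries, taylorSum_single hj, hterm j _ ht, (hsum j t ht).tsum_eq]
  -- By linearity Σ b_j V_j plays the role of v for initial data b and solves the integral equation
  -- with right-hand side Σ b_k f_k.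
  have hcomb : ∀ b : ℕ → ℝ, MemC γ T (fun t => ∑ j ∈ Finset.range n, b j * V j t) ∧
      EqOn (fun t => ∑ j ∈ Finset.range n, b j * ySeries T m α a j t) (fun t =>
        taylorSum n b t + rlInt n (fun t => ∑ j ∈ Finset.range n, b j * V j t) t) (Icc 0 T) ∧
      ∀ t ∈ Ioc 0 T, rlInt γ (fun t => ∑ j ∈ Finset.range n, b j * V j t) t =
        -(opK m α a (rlInt γ fun t => ∑ j ∈ Finset.range n, b j * V j t) t +
          ∑ k ∈ Finset.range n, b k * source T m α a k t) := by
    intro b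
    have hm : ∀ j ∈ Finset.range n, MemC γ T (fun t => b j * V j t) :=
      fun j _ => (hV j).const_mul _
    have hγsum : ∀ t ∈ Icc 0 T, rlInt γ (fun t => ∑ j ∈ Finset.range n, b j * V j t) t =
        ∑ j ∈ Finset.range n, b j * rlInt γ (V j) t := fun t ht => by
      rw [rlInt_sum hT hm hγ1 hγ0 ht]
      simp only [rlInt_const_mul]
    refine ⟨MemC.sum hm, fun t ht => ?_, fun t ht => ?_⟩
    · simp only
      rw [rlInt_sum hT hm hγ1 hn0.le ht, taylorSum, ← Finset.sum_add_distrib]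
      refine Finset.sum_congr rfl fun j hj => ?_
      have hj' := Finset.mem_range.1 hj
      have h1 : ySeries T m α a j t = Phi j t + rlInt n (V j) t := by
        rw [hy j hj' ht]
        simp only [taylorSum_single hj']
      rw [h1, rlInt_const_mul]
      ring
    · have ht' : t ∈ Icc 0 T := ⟨ht.1.le, ht.2⟩
      have h1 : EqOn (rlInt γ fun t => ∑ j ∈ Finset.range n, b j * V j t)
          (fun t => ∑ j ∈ Finset.range n, b j * rlInt γ (V j) t) (Ioc 0 T) :=
        fun s hs => hγsum s ⟨hs.1.le, hs.2⟩
      rw [opK_congr hαlt h1 ht, opK_sum hT hαlt (fun j _ => hm0 (hV j)) ht', hγsum t ht',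
        ← Finset.sum_add_distrib, ← Finset.sum_neg_distrib]
      refine Finset.sum_congr rfl fun j _ => ?_
      rw [hVeq j t ht]
      ring
  refine ⟨fun j hj => ⟨fun t ht => ?_, fun k => ?_, ?_, ?_⟩, fun j hj => ⟨?_, fun k hk => ?_⟩,
    fun b => ⟨?_, ⟨?_, fun k hk => ?_⟩, fun y hyC hyS t ht => ?_⟩⟩
  · simp only [hterm j _ ht]
    exact (hsum j t ht).summable
  · refine memCn_taylorSum_add_rlInt (b := fun _ => 0) hT (hv j k) hγ1 hnne fun t ht => ?_
    simp [hterm j k ht, taylorSum]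
  · exact memCn_taylorSum_add_rlInt hT (hV j) hγ1 hnne (hy j hj)
  · refine tendstoCn_taylorSum_add_rlInt hT hγ0 hγ1 hnne (hV j)
      (fun N => MemC.sum fun k _ => hv j k) (htail j) (hy j hj) fun N t ht => ?_
    simp only [taylorSum_single hj]
    rw [rlInt_sum hT (fun k _ => hv j k) hγ1 hn0.le ht]
    simp only [hterm j _ ht]
  · refine (hsol (hV j) (hy j hj)).2 fun t ht => ?_
    rw [hVeq j t ⟨ht.1, ht.2.le⟩]
    simp [hj]
  · rw [derivAtZero_taylorSum_add_rlInt hT (hV j) hγ1 hk (hy j hj)]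
  · exact memCn_taylorSum_add_rlInt hT (hcomb b).1 hγ1 hnne (hcomb b).2.1
  · exact (hsol (hcomb b).1 (hcomb b).2.1).2 fun t ht => (hcomb b).2.2 t ⟨ht.1, ht.2.le⟩
  · exact derivAtZero_taylorSum_add_rlInt hT (hcomb b).1 hγ1 hk (hcomb b).2.1
  · obtain ⟨hWm, hW, hWeq⟩ := hcomb b
    set W : ℝ → ℝ := fun t => ∑ j ∈ Finset.range n, b j * V j t
    obtain ⟨w, hw, hyw⟩ := hyC.eqOn_taylorSum_add_rlInt hT hγ1 hnne
    have htay : taylorSum n (fun k => derivAtZero T k y) = taylorSum n b := by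
      ext s
      exact Finset.sum_congr rfl fun k hk => by simp only [hyS.2 k (Finset.mem_range.1 hk)]
    rw [htay] at hyw
    have hweq := (hsol hw hyw).1 hyS.1
    have hmu := hm0 hw
    have hmW := hm0 hWm
    -- Both solutions have the same Taylor polynomial, hence the same inhomogeneity; the difference
    -- of their functions u solves the homogeneous equation.
    have hzero := eqOn_zero_of_eq_neg_opK hT hαlt ha'.continuousOn (hmu.sub hmW) fun s hs => by
      have h1 : opK m α a (fun t => rlInt γ w t - rlInt γ W t) s =
          opK m α a (rlInt γ w) s - opK m α a (rlInt γ W) s := by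
        simp only [opK]
        rw [← Finset.sum_sub_distrib]
        refine Finset.sum_congr rfl fun i hi => ?_
        rw [rlInt_sub hT hmu hmW one_pos (sub_pos.2 (hαlt i hi)).le ⟨hs.1.le, hs.2.le⟩]
        ring
      rw [h1, hweq s hs, hWeq s ⟨hs.1, hs.2.le⟩]
      ring
    rw [hyw ht, hW ht]
    simp only
    rw [← rlInt_order_eqOn hT hγ0 hγ1 hα₀ hnα hw ht, ← rlInt_order_eqOn hT hγ0 hγ1 hα₀ hnα hWm ht]
    congr 1
    -- The two functions u are known to agree only on the open interval; an integral of positive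
    -- order does not see the end points.
    exact rlInt_congr_Ioo hα₀ ht.1 fun s hs => sub_eq_zero.1 (hzero s ⟨hs.1, hs.2.trans_le ht.2⟩)
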